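/- Throughout, $\mathbb K$ is an arbitrary field, $G$ a finite group, and modules are right modules. **Definitions.** A *weak $G$-action* on a (weak) Hopf algebra $A$ consists of (weak) Hopf algebra automorphisms $\varphi_g$ ($g\in G$) and invertible elements $c_{g,h}\in A^\times$ ($g,h\in G$) with $$\varphi_g\varphi_h(a)=c_{g,h}\,\varphi_{gh}(a)\,c_{g,h}^{-1},\qquad \varphi_g(c_{h,k})\,c_{g,hk}=c_{g,h}\,c_{gh,k},\qquad c_{1,1}=1,\qquad \Delta(c_{g,h})=(c_{g,h}\otimes c_{g,h})\Delta(1);$$ it is *strict* if all $c_{g,h}=1$. A *$G$-(weak) Hopf algebra* is a (weak) Hopf algebra with weak $G$-action and a vector space decomposition $A=\bigoplus_{g\in G}A_g$ such that $A_gA_g\subseteq A_g$, $A_gA_h=0$ for $g\ne h$, $\varphi_g(A_h)\subseteq A_{ghg^{-1}}$ and $\Delta(A_g)\subseteq\bigoplus_{pq=g}A_p\otimes A_q$. For a weak Hopf algebra $A$, with $\epsilon_s(x)=(\mathrm{id}\otimes\epsilon)((1\otimes x)\Delta(1))$ and $\epsilon_t(x)=(\epsilon\otimes\mathrm{id})(\Delta(1)(x\otimes1))$,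 the category $A\text{-mod}$ is a tensor category with $M\bar\otimes N=(M\otimes N)\Delta(1)$, unit object $A_s=\epsilon_s(A)$ with $z.a=\epsilon_s(za)$, associativity constraint induced by that of vector spaces, and unit constraints the restrictions of $\epsilon\otimes\mathrm{id}$ and $\mathrm{id}\otimes\epsilon$ (for a Hopf algebra this is the usual tensor product). $G$ acts on it by the tensor functors $M\mapsto{}^gM$, where ${}^gM$ is $M$ with the action $m.\varphi_{g^{-1}}(a)$, and by the compositors ${}^g({}^hM)\to{}^{gh}M$, $m\mapsto m.c_{h^{-1},g^{-1}}$. If $A$ is graded, $M$ is *of degree $h$* if $M.A_g=0$ for all $g\neq h$. A *strictification* of a Hopf algebra $A$ with weak $G$-action is a weak Hopf algebra $B$ with strict $G$-action together with an equivalence $A\text{-mod}\simeq B\text{-mod}$ of tensor categories with $G$-action: a $\mathbb K$-linear equivalence $F$ with a strong tensor structure and natural monoidal isomorphisms $\psi_g\colon F({}^gM)\to{}^gF(M)$ compatible with the compositors, such that $F(M)$ is finite-dimensional if and only if $M$ is. A *strictification* of a $G$-Hopf algebra is the same with $B$ a $G$-weak Hopf algebra with strict $G$-action, such that $F(M)$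 is of degree $h$ if and only if $M$ is. **Theorem.** 1. Every Hopf algebra $A$ over $\mathbb K$ with a weak $G$-action has a strictification. 2. Every $G$-Hopf algebra $A$ over $\mathbb K$ has a strictification as a $G$-Hopf algebra. In both cases the strictification can be taken to be $A^{str}=\mathbb K(G)\otimes A\otimes\mathbb K[G]$ with (where $\delta_g$, $h$ are the standard bases of $\mathbb K(G)$ and $\mathbb K[G]$, and $\delta(\cdot,\cdot)$ is the Kronecker delta) $$(\delta_g\otimes a\otimes h)(\delta_{g'}\otimes a'\otimes h')=\delta(gh',g')\,\delta_{g'}\otimes a\,\varphi_h(a')\,c_{h,h'}\otimes hh',\qquad 1=\sum_{g}\delta_g\otimes1\otimes1,$$ $$\Delta(\delta_g\otimes a\otimes h)=\sum_{(a)}(\delta_g\otimes a_{(1)}\otimes h)\otimes(\delta_g\otimes a_{(2)}\otimes h),\qquad \epsilon(\delta_g\otimes a\otimes h)=\epsilon_A(a),$$ $$S(\delta_g\otimes a\otimes h)=\delta_{gh^{-1}}\otimes c_{h^{-1},h}^{-1}\varphi_{h^{-1}}(S_A(a))\otimes h^{-1},$$ whose counital subalgebras $\epsilon_t(A^{str})$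 and $\epsilon_s(A^{str})$ are both $\mathbb K(G)\otimes 1\otimes 1$, with the strict $G$-action by translation $x\cdot(\delta_g\otimes a\otimes h)=\delta_{xg}\otimes a\otimes h$, and with $F(M)=M\otimes\mathbb K[G]$, $F(f)=f\otimes\mathrm{id}$, where $$(m\otimes k).(\delta_g\otimes a\otimes h)=\delta(kh,g)\; m.\varphi_k(a)c_{k,h}\otimes g .$$ -/

import Mathlib

open TensorProduct Coalgebra

universe u

set_option linter.unusedSectionVars false

namespace GHopf

/-! ### Weak Hopf algebras -/

section WeakHopf

/-- The target counital map `ε_t(x) = (ε ⊗ id)(Δ(1) (x ⊗ 1))`. -/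
noncomputable def counitT (k A : Type*) [Field k] [Ring A] [Algebra k A] [Coalgebra k A] :
    A →ₗ[k] A :=
  (TensorProduct.lid k A).toLinearMap ∘ₗ (counit (R := k) (A := A)).rTensor A ∘ₗ
    LinearMap.mulLeft k (comul (R := k) (1 : A)) ∘ₗ (TensorProduct.mk k A A).flip 1

/-- The source counital map `ε_s(x) = (id ⊗ ε)((1 ⊗ x) Δ(1))`. -/
noncomputable def counitS (k A : Type*) [Field k] [Ring A] [Algebra k A] [Coalgebra k A] :
    A →ₗ[k] A :=
  (TensorProduct.rid k A).toLinearMap ∘ₗ (counit (R := k) (A := A)).lTensor A ∘ₗ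
    LinearMap.mulRight k (comul (R := k) (1 : A)) ∘ₗ TensorProduct.mk k A A 1

/-- A weak Hopf algebra over a field `k`: a unital algebra and counital coalgebra whose
coproduct is multiplicative (but not necessarily unital), whose unit and counit satisfy the
weak compatibility axioms, together with an antipode. -/
class WeakHopfAlgebra (k A : Type*) [Field k] [Ring A] [Algebra k A] [Coalgebra k A] where
  /-- `Δ(ab) = Δ(a)Δ(b)` -/
  comul_mul : ∀ a b : A, comul (R := k) (a * b) = comul (R := k) a * comul (R := k) b
  /-- `(id ⊗ Δ)(Δ(1)) = (Δ(1) ⊗ 1)(1 ⊗ Δ(1))` -/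
  comul_one_left : (comul (R := k) (A := A)).lTensor A (comul (R := k) (1 : A)) =
    TensorProduct.assoc k A A A (comul (R := k) (1 : A) ⊗ₜ[k] (1 : A)) *
      ((1 : A) ⊗ₜ[k] comul (R := k) (1 : A))
  /-- `(id ⊗ Δ)(Δ(1)) = (1 ⊗ Δ(1))(Δ(1) ⊗ 1)` -/
  comul_one_right : (comul (R := k) (A := A)).lTensor A (comul (R := k) (1 : A)) =
    ((1 : A) ⊗ₜ[k] comul (R := k) (1 : A)) *
      TensorProduct.assoc k A A A (comul (R := k) (1 : A) ⊗ₜ[k] (1 : A))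
  /-- `ε(xyz) = ε(x y₁) ε(y₂ z)` -/
  counit_mul_left : ∀ x y z : A, counit (R := k) (x * y * z) =
    LinearMap.mul' k k (TensorProduct.map (counit (R := k) ∘ₗ LinearMap.mulLeft k x)
      (counit (R := k) ∘ₗ LinearMap.mulRight k z) (comul (R := k) y))
  /-- `ε(xyz) = ε(x y₂) ε(y₁ z)` -/
  counit_mul_right : ∀ x y z : A, counit (R := k) (x * y * z) =
    LinearMap.mul' k k (TensorProduct.map (counit (R := k) ∘ₗ LinearMap.mulRight k z)
      (counit (R := k) ∘ₗ LinearMap.mulLeft k x) (comul (R := k) y))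
  /-- the antipode `S` -/
  antipode : A →ₗ[k] A
  /-- `x₁ S(x₂) = ε_t(x)` -/
  mul_antipode : ∀ x : A,
    LinearMap.mul' k A (antipode.lTensor A (comul (R := k) x)) = counitT k A x
  /-- `S(x₁) x₂ = ε_s(x)` -/
  antipode_mul : ∀ x : A,
    LinearMap.mul' k A (antipode.rTensor A (comul (R := k) x)) = counitS k A x
  /-- `S(x₁) (x₂ S(x₃)) = S(x)` -/
  antipode_mul_antipode : ∀ x : A,
    LinearMap.mul' k A (TensorProduct.map antipode
      (LinearMap.mul' k A ∘ₗ antipode.lTensor A ∘ₗ comul (R := k)) (comul (R := k) x)) =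
        antipode x

end WeakHopf

section HopfToWeak

variable {k A : Type*} [Field k] [Ring A] [HopfAlgebra k A]

theorem hopf_counitT (x : A) : counitT k A x = algebraMap k A (counit (R := k) x) := by
  simp [counitT, Bialgebra.comul_one, Algebra.TensorProduct.one_def, Algebra.algebraMap_eq_smul_one]

theorem hopf_counitS (x : A) : counitS k A x = algebraMap k A (counit (R := k) x) := by
  simp [counitS, Bialgebra.comul_one, Algebra.TensorProduct.one_def, Algebra.algebraMap_eq_smul_one]

theorem sum_counit_smul' (x : A) : ∑ i ∈ (Repr.arbitrary k x).index,
    counit (R := k) ((Repr.arbitrary k x).right i) • (Repr.arbitrary k x).left i = x := by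
  simpa only [map_sum, TensorProduct.rid_tmul, one_smul] using
    congrArg (TensorProduct.rid k A) (sum_tmul_counit_eq (Repr.arbitrary k x))

/-- Every Hopf algebra is a weak Hopf algebra. -/
noncomputable instance : WeakHopfAlgebra k A where
  comul_mul := Bialgebra.comul_mul
  comul_one_left := by
    simp [Bialgebra.comul_one, Algebra.TensorProduct.one_def]
  comul_one_right := by
    simp [Bialgebra.comul_one, Algebra.TensorProduct.one_def]
  counit_mul_left x y z := by
    have h := congrArg (fun w => counit (R := k) x * counit (R := k) w * counit (R := k) z)
      (sum_counit_smul (Repr.arbitrary k y))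
    conv_rhs => rw [← (Repr.arbitrary k y).eq]
    simp only [map_sum, map_smul, smul_eq_mul, Finset.mul_sum, Finset.sum_mul] at h
    simp only [map_sum, Bialgebra.counit_mul, ← h, TensorProduct.map_tmul, LinearMap.comp_apply,
      LinearMap.mulLeft_apply, LinearMap.mulRight_apply, LinearMap.mul'_apply]
    exact Finset.sum_congr rfl fun _ _ => by ring
  counit_mul_right x y z := by
    have h := congrArg (fun w => counit (R := k) x * counit (R := k) w * counit (R := k) z)
      (sum_counit_smul (Repr.arbitrary k y))
    conv_rhs => rw [← (Repr.arbitrary k y).eq]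
    simp only [map_sum, map_smul, smul_eq_mul, Finset.mul_sum, Finset.sum_mul] at h
    simp only [map_sum, Bialgebra.counit_mul, ← h, TensorProduct.map_tmul, LinearMap.comp_apply,
      LinearMap.mulLeft_apply, LinearMap.mulRight_apply, LinearMap.mul'_apply]
    exact Finset.sum_congr rfl fun _ _ => by ring
  antipode := HopfAlgebra.antipode k
  mul_antipode x := by
    rw [hopf_counitT]; exact HopfAlgebra.mul_antipode_lTensor_comul_apply x
  antipode_mul x := by
    rw [hopf_counitS]; exact HopfAlgebra.mul_antipode_rTensor_comul_apply x
  antipode_mul_antipode x := by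
    have h := congrArg (HopfAlgebra.antipode k) (sum_counit_smul' (k := k) x)
    conv_lhs => rw [← (Repr.arbitrary k x).eq]
    simp only [map_sum, TensorProduct.map_tmul, LinearMap.comp_apply, LinearMap.mul'_apply,
      HopfAlgebra.mul_antipode_lTensor_comul_apply]
    rw [← h, map_sum]
    exact Finset.sum_congr rfl fun _ _ => by
      rw [map_smul, Algebra.smul_def, Algebra.commutes]

end HopfToWeak

/-! ### Identities in weak Hopf algebras -/

section Identities

section

variable {k A : Type*} [Field k] [Ring A] [Algebra k A]

/-- The map `x ⊗ y ↦ f(x) y`. -/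
noncomputable def conL (f : A →ₗ[k] k) : A ⊗[k] A →ₗ[k] A :=
  (TensorProduct.lid k A).toLinearMap ∘ₗ f.rTensor A

/-- The map `x ⊗ y ↦ f(y) x`. -/
noncomputable def conR (f : A →ₗ[k] k) : A ⊗[k] A →ₗ[k] A :=
  (TensorProduct.rid k A).toLinearMap ∘ₗ f.lTensor A

@[simp] theorem conL_tmul (f : A →ₗ[k] k) (x y : A) : conL f (x ⊗ₜ y) = f x • y := by simp [conL]
@[simp] theorem conR_tmul (f : A →ₗ[k] k) (x y : A) : conR f (x ⊗ₜ y) = f y • x := by simp [conR]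

end

variable {k A : Type*} [Field k] [Ring A] [Algebra k A] [Coalgebra k A]

theorem counitS_of_repr {ι : Type*} (r : Repr k (1 : A) ι) (x : A) :
    counitS k A x = ∑ i ∈ r.index, counit (R := k) (x * r.right i) • r.left i := by
  simp [counitS, ← r.eq, Finset.mul_sum]

theorem counitT_of_repr {ι : Type*} (r : Repr k (1 : A) ι) (x : A) :
    counitT k A x = ∑ i ∈ r.index, counit (R := k) (r.left i * x) • r.right i := by
  simp [counitT, ← r.eq, Finset.sum_mul]

theorem repr_counit_left {ι : Type*} {x : A} (r : Repr k x ι) :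
    ∑ i ∈ r.index, counit (R := k) (r.left i) • r.right i = x := sum_counit_smul r

theorem repr_counit_right {ι : Type*} {x : A} (r : Repr k x ι) :
    ∑ i ∈ r.index, counit (R := k) (r.right i) • r.left i = x := by
  simpa only [map_sum, TensorProduct.rid_tmul, one_smul] using
    congrArg (TensorProduct.rid k A) (sum_tmul_counit_eq r)

/-- The functional `w ↦ ε(xw)`. -/
noncomputable def epsL (k : Type*) {A : Type*} [Field k] [Ring A] [Algebra k A] [Coalgebra k A]
    (x : A) : A →ₗ[k] k := counit (R := k) ∘ₗ LinearMap.mulLeft k x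

/-- The functional `w ↦ ε(wx)`. -/
noncomputable def epsR (k : Type*) {A : Type*} [Field k] [Ring A] [Algebra k A] [Coalgebra k A]
    (x : A) : A →ₗ[k] k := counit (R := k) ∘ₗ LinearMap.mulRight k x

@[simp] theorem epsL_apply (x w : A) : epsL k x w = counit (R := k) (x * w) := rfl
@[simp] theorem epsR_apply (x w : A) : epsR k x w = counit (R := k) (w * x) := rfl

theorem conL_counit_comul (x : A) : conL (counit (R := k)) (comul (R := k) x) = x := by
  conv_lhs => rw [← (Repr.arbitrary k x).eq]
  simp [repr_counit_left]

theorem conR_counit_comul (x : A) : conR (counit (R := k)) (comul (R := k) x) = x := by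
  conv_lhs => rw [← (Repr.arbitrary k x).eq]
  simp [repr_counit_right]

theorem counitS_eq (x : A) : counitS k A x = conR (epsL k x) (comul (R := k) 1) := by
  rw [counitS_of_repr (Repr.arbitrary k 1)]
  conv_rhs => rw [← (Repr.arbitrary k (1 : A)).eq]
  simp

theorem coassoc_repr {ι : Type*} {x : A} (r : Repr k x ι) :
    ∑ i ∈ r.index, TensorProduct.assoc k A A A (comul (R := k) (r.left i) ⊗ₜ[k] r.right i) =
    ∑ i ∈ r.index, r.left i ⊗ₜ[k] comul (R := k) (r.right i) := by
  have h := coassoc_apply (R := k) x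
  rw [← r.eq] at h
  simpa using h

variable (k A) in
theorem counitS_one : counitS k A 1 = 1 := by
  rw [counitS_of_repr (Repr.arbitrary k 1)]
  simpa using repr_counit_right (Repr.arbitrary k (1 : A))

variable [WeakHopfAlgebra k A]

theorem comul_one_mul (x : A) : comul (R := k) (1 : A) * comul (R := k) x = comul (R := k) x := by
  rw [← WeakHopfAlgebra.comul_mul, one_mul]

theorem comul_mul_one (x : A) : comul (R := k) x * comul (R := k) (1 : A) = comul (R := k) x := by
  rw [← WeakHopfAlgebra.comul_mul, mul_one]

theorem counit_mul_of_repr {ι : Type*} (r : Repr k (1 : A) ι) (x y : A) :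
    counit (R := k) (x * y) =
      ∑ i ∈ r.index, counit (R := k) (x * r.right i) * counit (R := k) (r.left i * y) := by
  have h := WeakHopfAlgebra.counit_mul_right (k := k) x 1 y
  rw [mul_one, ← r.eq] at h
  simpa [mul_comm] using h

theorem counit_mul_of_repr' {ι : Type*} (r : Repr k (1 : A) ι) (x y : A) :
    counit (R := k) (x * y) =
      ∑ i ∈ r.index, counit (R := k) (x * r.left i) * counit (R := k) (r.right i * y) := by
  have h := WeakHopfAlgebra.counit_mul_left (k := k) x 1 y
  rw [mul_one, ← r.eq] at h
  simpa using h

theorem counit_mul_mul_of_repr {ι : Type*} {y : A} (r : Repr k y ι) (x z : A) :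
    counit (R := k) (x * y * z) =
      ∑ i ∈ r.index, counit (R := k) (x * r.left i) * counit (R := k) (r.right i * z) := by
  have h := WeakHopfAlgebra.counit_mul_left (k := k) x y z
  rw [← r.eq] at h
  simpa using h

/-- `Δ(1)₁ ⊗ Δ(Δ(1)₂)` expanded with the second factor order `1₂ 1₁'`. -/
theorem weak_left {ι : Type*} (r : Repr k (1 : A) ι) :
    ∑ i ∈ r.index, r.left i ⊗ₜ[k] comul (R := k) (r.right i) =
      ∑ i ∈ r.index, ∑ j ∈ r.index,
        r.left i ⊗ₜ[k] ((r.right i * r.left j) ⊗ₜ[k] r.right j) := by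
  have h := WeakHopfAlgebra.comul_one_left (k := k) (A := A)
  rw [← r.eq] at h
  simpa [TensorProduct.sum_tmul, TensorProduct.tmul_sum, Finset.sum_mul_sum] using h

theorem weak_right {ι : Type*} (r : Repr k (1 : A) ι) :
    ∑ i ∈ r.index, r.left i ⊗ₜ[k] comul (R := k) (r.right i) =
      ∑ i ∈ r.index, ∑ j ∈ r.index,
        r.left i ⊗ₜ[k] ((r.left j * r.right i) ⊗ₜ[k] r.right j) := by
  have h := WeakHopfAlgebra.comul_one_right (k := k) (A := A)
  rw [← r.eq] at h
  rw [Finset.sum_comm]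
  simpa [TensorProduct.sum_tmul, TensorProduct.tmul_sum, Finset.sum_mul_sum] using h

/-- `y 1₁ ⊗ 1₂ = y₁ ⊗ ε(y₂ 1₁) 1₂` -/
theorem mul_comul_one (y : A) : (y ⊗ₜ[k] (1 : A)) * comul (R := k) (1 : A) =
    ∑ i ∈ (Repr.arbitrary k y).index, (Repr.arbitrary k y).left i ⊗ₜ[k]
      conL (epsL k ((Repr.arbitrary k y).right i)) (comul (R := k) 1) := by
  set r := Repr.arbitrary k (1 : A)
  set s := Repr.arbitrary k y
  let T : A → A → A ⊗[k] (A ⊗[k] A) →ₗ[k] A ⊗[k] A := fun c d =>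
    TensorProduct.map (LinearMap.mulLeft k c) (conL (epsL k d))
  have key : ∀ (c d : A) (X : A ⊗[k] A) (w : A), T c d (TensorProduct.assoc k A A A (X ⊗ₜ w)) =
      conR (counit (R := k)) ((c ⊗ₜ[k] d) * X) ⊗ₜ w := by
    intro c d X w
    induction X with
    | zero => simp
    | tmul u v => simp [T, TensorProduct.smul_tmul]
    | add u v hu hv => simp only [TensorProduct.add_tmul, map_add, mul_add, hu, hv]
  have h1 : ∑ n ∈ s.index, ∑ i ∈ r.index, T (s.left n) (s.right n)
      (TensorProduct.assoc k A A A (comul (R := k) (r.left i) ⊗ₜ[k] r.right i)) =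
      (y ⊗ₜ[k] (1 : A)) * comul (R := k) (1 : A) := by
    simp only [key]
    rw [Finset.sum_comm]
    simp only [← TensorProduct.sum_tmul, ← map_sum, ← Finset.sum_mul, s.eq,
      ← WeakHopfAlgebra.comul_mul, conR_counit_comul]
    rw [← r.eq, Finset.mul_sum]; simp
  rw [← h1]
  have hco : ∀ c d : A, _ := fun c d =>
    congrArg (T c d) ((coassoc_repr r).trans (weak_left r))
  simp only [map_sum] at hco
  simp only [hco]
  simp only [T, TensorProduct.map_tmul, conL_tmul, LinearMap.mulLeft_apply, epsL_apply]
  have h2 : ∑ n ∈ s.index, s.left n ⊗ₜ[k] conL (epsL k (s.right n)) (comul (R := k) 1) =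
      TensorProduct.map LinearMap.id (∑ i ∈ r.index,
        (epsR k (r.left i)).smulRight (r.right i)) (comul (R := k) y * comul (R := k) (1 : A)) := by
    rw [comul_mul_one, ← s.eq, ← r.eq]
    simp
  rw [h2, ← s.eq, ← r.eq, Finset.sum_mul_sum, map_sum]
  refine Finset.sum_congr rfl fun n _ => ?_
  rw [map_sum]
  refine Finset.sum_congr rfl fun i _ => ?_
  simp [TensorProduct.tmul_sum, mul_assoc]

/-- `ε_s(x) y = y₁ ε(x y₂)` -/
theorem counitS_mul (x y : A) :
    counitS k A x * y = conR (epsL k x) (comul (R := k) y) := by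
  set r := Repr.arbitrary k (1 : A)
  set s := Repr.arbitrary k y
  let T : A → A → A ⊗[k] (A ⊗[k] A) →ₗ[k] A := fun c d =>
    (TensorProduct.rid k A).toLinearMap ∘ₗ TensorProduct.map (LinearMap.mulRight k c)
      (LinearMap.mul' k k ∘ₗ TensorProduct.map (epsR k d) (epsL k x))
  have key : ∀ (c d : A) (X : A ⊗[k] A) (w : A), T c d (TensorProduct.assoc k A A A (X ⊗ₜ w)) =
      counit (R := k) (x * w) • conR (counit (R := k)) (X * (c ⊗ₜ[k] d)) := by
    intro c d X w
    induction X with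
    | zero => simp
    | tmul u v => simp [T, smul_smul, mul_comm]
    | add u v hu hv => simp only [TensorProduct.add_tmul, map_add, add_mul, hu, hv, smul_add]
  have h1 : ∑ n ∈ s.index, ∑ i ∈ r.index, T (s.left n) (s.right n)
      (TensorProduct.assoc k A A A (comul (R := k) (r.left i) ⊗ₜ[k] r.right i)) =
      counitS k A x * y := by
    simp only [key]
    rw [Finset.sum_comm]
    simp only [← Finset.smul_sum, ← map_sum, ← Finset.mul_sum, s.eq,
      ← WeakHopfAlgebra.comul_mul, conR_counit_comul]
    rw [counitS_of_repr r, Finset.sum_mul]; simp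
  rw [← h1]
  have hco : ∀ c d : A, _ := fun c d =>
    congrArg (T c d) ((coassoc_repr r).trans (weak_right r))
  simp only [map_sum] at hco
  simp only [hco]
  rw [← comul_one_mul y, ← r.eq, ← s.eq, Finset.sum_mul_sum, Finset.sum_comm, map_sum]
  refine Finset.sum_congr rfl fun n _ => ?_
  rw [map_sum]
  refine Finset.sum_congr rfl fun i _ => ?_
  simp only [T, LinearMap.comp_apply, TensorProduct.map_tmul, LinearMap.mul'_apply,
    LinearEquiv.coe_coe, TensorProduct.rid_tmul, epsR_apply, epsL_apply,
    LinearMap.mulRight_apply, Algebra.TensorProduct.tmul_mul_tmul, conR_tmul]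
  rw [← Finset.sum_smul, counit_mul_of_repr r x]
  congr 1
  refine Finset.sum_congr rfl fun j _ => ?_
  rw [mul_comm, mul_assoc]

/-- `ε_s(h₁) ⊗ h₂ = 1₁ ⊗ h 1₂` -/
theorem counitS_rTensor_comul (h : A) : (counitS k A).rTensor A (comul (R := k) h) =
    ((1 : A) ⊗ₜ[k] h) * comul (R := k) (1 : A) := by
  set r := Repr.arbitrary k (1 : A)
  set s := Repr.arbitrary k h
  let T : A → A → A ⊗[k] (A ⊗[k] A) →ₗ[k] A ⊗[k] A := fun c d =>
    (LinearMap.mulLeft k d ∘ₗ conL (epsL k c)).lTensor A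
  have key : ∀ (c d : A) (X : A ⊗[k] A) (w : A), T c d (w ⊗ₜ X) =
      w ⊗ₜ conL (counit (R := k)) ((c ⊗ₜ[k] d) * X) := by
    intro c d X w
    induction X with
    | zero => simp
    | tmul u v => simp [T]
    | add u v hu hv => simp only [TensorProduct.tmul_add, map_add, mul_add, hu, hv]
  have h1 : ∑ n ∈ s.index, ∑ i ∈ r.index, T (s.left n) (s.right n)
      (r.left i ⊗ₜ comul (R := k) (r.right i)) =
      ((1 : A) ⊗ₜ[k] h) * comul (R := k) (1 : A) := by
    simp only [key]
    rw [Finset.sum_comm]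
    simp only [← TensorProduct.tmul_sum, ← map_sum, ← Finset.sum_mul, s.eq,
      ← WeakHopfAlgebra.comul_mul, conL_counit_comul]
    rw [← r.eq, Finset.mul_sum]; simp
  rw [← h1]
  simp only [← map_sum]
  simp only [weak_right r]
  rw [← comul_mul_one h, ← r.eq, ← s.eq, Finset.sum_mul_sum, map_sum]
  refine Finset.sum_congr rfl fun n _ => ?_
  rw [map_sum, map_sum]
  simp only [map_sum]
  rw [Finset.sum_comm]
  refine Finset.sum_congr rfl fun i _ => ?_
  simp only [T, Algebra.TensorProduct.tmul_mul_tmul, LinearMap.rTensor_tmul, LinearMap.lTensor_tmul,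
    LinearMap.comp_apply, conL_tmul, epsL_apply, counitS_of_repr r, TensorProduct.sum_tmul,
    LinearMap.mulLeft_apply, mul_assoc, TensorProduct.smul_tmul, mul_smul_comm]

/-- `ε(x h₁) h₂ = ε(x 1₁) 1₂ h` -/
theorem conL_epsL_comul (x h : A) : conL (epsL k x) (comul (R := k) h) =
    conL (epsL k x) (comul (R := k) 1) * h := by
  set r := Repr.arbitrary k (1 : A)
  set s := Repr.arbitrary k h
  let T : A → A → A ⊗[k] (A ⊗[k] A) →ₗ[k] A := fun c d =>
    (TensorProduct.lid k A).toLinearMap ∘ₗ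
      TensorProduct.map (epsL k x) (LinearMap.mulRight k d ∘ₗ conL (epsR k c))
  have key : ∀ (c d : A) (X : A ⊗[k] A) (w : A), T c d (w ⊗ₜ X) =
      counit (R := k) (x * w) • conL (counit (R := k)) (X * (c ⊗ₜ[k] d)) := by
    intro c d X w
    induction X with
    | zero => simp
    | tmul u v => simp [T, smul_smul, mul_comm]
    | add u v hu hv => simp only [TensorProduct.tmul_add, map_add, add_mul, hu, hv, smul_add]
  have h1 : ∑ n ∈ s.index, ∑ i ∈ r.index, T (s.left n) (s.right n)
      (r.left i ⊗ₜ comul (R := k) (r.right i)) =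
      conL (epsL k x) (comul (R := k) 1) * h := by
    simp only [key]
    rw [Finset.sum_comm]
    simp only [← Finset.smul_sum, ← map_sum, ← Finset.mul_sum, s.eq,
      ← WeakHopfAlgebra.comul_mul, conL_counit_comul]
    rw [← r.eq, map_sum, Finset.sum_mul]; simp
  rw [← h1]
  simp only [← map_sum]
  simp only [weak_left r]
  rw [← comul_one_mul h, ← r.eq, ← s.eq, Finset.sum_mul_sum, Finset.sum_comm, map_sum]
  refine Finset.sum_congr rfl fun n _ => ?_
  rw [map_sum, map_sum]
  simp only [map_sum]
  rw [Finset.sum_comm]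
  refine Finset.sum_congr rfl fun i _ => ?_
  simp only [T, Algebra.TensorProduct.tmul_mul_tmul, TensorProduct.map_tmul,
    LinearMap.comp_apply, conL_tmul, epsL_apply, epsR_apply, LinearEquiv.coe_coe,
    TensorProduct.lid_tmul, LinearMap.mulRight_apply, smul_mul_assoc, smul_smul]
  rw [← Finset.sum_smul, counit_mul_of_repr' r x]
  simp only [mul_assoc]

/-- `ε(ε_s(x) w) = ε(x w)` -/
theorem counit_counitS_mul (x w : A) :
    counit (R := k) (counitS k A x * w) = counit (R := k) (x * w) := by
  rw [counit_mul_of_repr (Repr.arbitrary k 1) x, counitS_of_repr (Repr.arbitrary k 1)]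
  simp [Finset.sum_mul]

theorem counit_counitS (x : A) : counit (R := k) (counitS k A x) = counit (R := k) x := by
  simpa using counit_counitS_mul (k := k) x 1

theorem counitS_counitS_mul (x y : A) :
    counitS k A (counitS k A x * y) = counitS k A (x * y) := by
  simp [counitS_of_repr (Repr.arbitrary k 1) (_ * y), mul_assoc, counit_counitS_mul]

theorem counitS_counitS (x : A) : counitS k A (counitS k A x) = counitS k A x := by
  simpa using counitS_counitS_mul (k := k) x 1

/-- `Δ(ε_s(x)) = 1₁ ⊗ ε_s(x) 1₂` -/
theorem comul_counitS (x : A) : comul (R := k) (counitS k A x) =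
    ((1 : A) ⊗ₜ[k] counitS k A x) * comul (R := k) (1 : A) := by
  set r := Repr.arbitrary k (1 : A)
  let T : A ⊗[k] (A ⊗[k] A) →ₗ[k] A ⊗[k] A := (conR (epsL k x)).lTensor A
  have key : ∀ (X : A ⊗[k] A) (w : A), T (TensorProduct.assoc k A A A (X ⊗ₜ w)) =
      counit (R := k) (x * w) • X := by
    intro X w
    induction X with
    | zero => simp
    | tmul u v => simp [T]
    | add u v hu hv => simp only [TensorProduct.add_tmul, map_add, hu, hv, smul_add]
  have h1 := congrArg T ((coassoc_repr r).trans (weak_right r))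
  simp only [map_sum, key] at h1
  rw [counitS_of_repr r]
  simp only [map_sum, map_smul]
  rw [h1]
  conv_rhs => rw [← r.eq, Finset.mul_sum]
  refine Finset.sum_congr rfl fun i _ => ?_
  simp [T, Finset.sum_mul, TensorProduct.tmul_sum]

/-- `ε_s(ε(x 1₁) 1₂) = ε_s(x)` -/
theorem counitS_conL (x : A) :
    counitS k A (conL (epsL k x) (comul (R := k) 1)) = counitS k A x := by
  set r := Repr.arbitrary k (1 : A)
  rw [counitS_of_repr r, counitS_of_repr r]
  refine Finset.sum_congr rfl fun i _ => ?_
  rw [counit_mul_of_repr' r x, ← r.eq]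
  simp [Finset.sum_mul]

/-- `h 1₁ ⊗ ε_s(1₂) = h₁ ⊗ ε_s(h₂)` -/
theorem counitS_lTensor_mul_comul (h : A) :
    (counitS k A).lTensor A ((h ⊗ₜ[k] (1 : A)) * comul (R := k) (1 : A)) =
      (counitS k A).lTensor A (comul (R := k) h) := by
  rw [mul_comul_one]
  conv_rhs => rw [← (Repr.arbitrary k h).eq]
  simp [counitS_conL]

/-- `ε_s(ε(z y₁) y₂) = ε_s(zy)` -/
theorem counitS_conL_comul (z y : A) :
    counitS k A (conL (epsL k z) (comul (R := k) y)) = counitS k A (z * y) := by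
  set r := Repr.arbitrary k (1 : A)
  rw [counitS_of_repr r, counitS_of_repr r]
  refine Finset.sum_congr rfl fun i _ => ?_
  rw [counit_mul_mul_of_repr (Repr.arbitrary k y) z, ← (Repr.arbitrary k y).eq]
  simp [Finset.sum_mul]

/-- `1₁' ⊗ ε(z 1₁) 1₂ 1₂' = ε_s(z 1₁) ⊗ 1₂` -/
theorem conL_mul_comul_one (z : A) :
    ((1 : A) ⊗ₜ[k] conL (epsL k z) (comul (R := k) 1)) * comul (R := k) (1 : A) =
      (counitS k A).rTensor A ((z ⊗ₜ[k] (1 : A)) * comul (R := k) (1 : A)) := by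
  set r := Repr.arbitrary k (1 : A)
  rw [← counitS_rTensor_comul]
  let T : A ⊗[k] (A ⊗[k] A) →ₗ[k] A ⊗[k] A :=
    (TensorProduct.lid k (A ⊗[k] A)).toLinearMap ∘ₗ
      TensorProduct.map (epsL k z) ((counitS k A).rTensor A)
  have key : ∀ (X : A ⊗[k] A) (w : A), T (TensorProduct.assoc k A A A (X ⊗ₜ w)) =
      counitS k A (conL (epsL k z) X) ⊗ₜ w := by
    intro X w
    induction X with
    | zero => simp
    | tmul u v => simp [T, TensorProduct.smul_tmul']
    | add u v hu hv => simp only [TensorProduct.add_tmul, map_add, hu, hv]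
  have h1 := congrArg T (coassoc_repr r)
  simp only [map_sum, key, counitS_conL_comul] at h1
  conv_rhs => rw [← r.eq, Finset.mul_sum, map_sum]
  simp only [Algebra.TensorProduct.tmul_mul_tmul, one_mul, LinearMap.rTensor_tmul]
  rw [h1]
  conv_lhs => rw [← r.eq]
  simp [T]

/-- `ε_s(ε_s(x) 1₁) ⊗ 1₂ = ε_s(x) 1₁ ⊗ 1₂` -/
theorem counitS_rTensor_mul_comul (x : A) :
    (counitS k A).rTensor A ((counitS k A x ⊗ₜ[k] (1 : A)) * comul (R := k) (1 : A)) =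
      (counitS k A x ⊗ₜ[k] (1 : A)) * comul (R := k) (1 : A) := by
  set r := Repr.arbitrary k (1 : A)
  let T : A ⊗[k] (A ⊗[k] A) →ₗ[k] A ⊗[k] A := (conL (epsL k x)).lTensor A
  have key : ∀ (X : A ⊗[k] A) (w : A), T (TensorProduct.assoc k A A A (X ⊗ₜ w)) =
      conR (epsL k x) X ⊗ₜ w := by
    intro X w
    induction X with
    | zero => simp
    | tmul u v => simp [T, TensorProduct.smul_tmul]
    | add u v hu hv => simp only [TensorProduct.add_tmul, map_add, hu, hv]
  have h1 := congrArg T ((coassoc_repr r).trans (weak_right r))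
  simp only [map_sum, key, ← counitS_mul] at h1
  rw [← r.eq, Finset.mul_sum, map_sum]
  simp only [Algebra.TensorProduct.tmul_mul_tmul, one_mul, LinearMap.rTensor_tmul,
    counitS_counitS_mul]
  rw [h1, Finset.sum_comm]
  refine Finset.sum_congr rfl fun j _ => ?_
  simp [T, counitS_of_repr r, TensorProduct.sum_tmul, mul_assoc, TensorProduct.smul_tmul]

end Identities

/-! ### The category of right modules -/

open CategoryTheory

/-- A right module over the `k`-algebra `A`, on a `k`-vector space: `act a m` is `m.a`. -/
structure RMod (k A : Type u) [Field k] [Ring A] [Algebra k A] where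
  /-- the underlying vector space -/
  carrier : Type u
  [isAddCommGroup : AddCommGroup carrier]
  [isModule : Module k carrier]
  /-- the right action, `act a m = m.a` -/
  act : A →ₗ[k] carrier →ₗ[k] carrier
  act_one : ∀ m, act 1 m = m
  act_mul : ∀ a b m, act (a * b) m = act b (act a m)

attribute [instance] RMod.isAddCommGroup RMod.isModule

namespace RMod

section Cat

variable {k A : Type u} [Field k] [Ring A] [Algebra k A]

instance : CoeSort (RMod k A) (Type u) := ⟨RMod.carrier⟩

/-- Morphisms of right modules. -/
@[ext]
structure Hom (M N : RMod k A) where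
  /-- the underlying linear map -/
  lin : M →ₗ[k] N
  comm : ∀ a m, lin (M.act a m) = N.act a (lin m)

instance : Category (RMod k A) where
  Hom M N := Hom M N
  id M := ⟨LinearMap.id, fun _ _ => rfl⟩
  comp f g := ⟨g.lin ∘ₗ f.lin, fun a m => by simp [f.comm, g.comm]⟩

theorem hom_ext {M N : RMod k A} {f g : M ⟶ N} (h : f.lin = g.lin) : f = g := Hom.ext h

@[simp] theorem id_lin (M : RMod k A) : Hom.lin (𝟙 M) = LinearMap.id := rfl
@[simp] theorem comp_lin {M N P : RMod k A} (f : M ⟶ N) (g : N ⟶ P) :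
    Hom.lin (f ≫ g) = g.lin ∘ₗ f.lin := rfl

theorem lin_injective (M N : RMod k A) :
    Function.Injective (fun f : M ⟶ N => f.lin) := fun _ _ h => hom_ext h

instance (M N : RMod k A) : Zero (M ⟶ N) := ⟨⟨0, by simp⟩⟩
instance (M N : RMod k A) : Add (M ⟶ N) := ⟨fun f g => ⟨f.lin + g.lin, by simp [f.comm, g.comm]⟩⟩
instance (M N : RMod k A) : Neg (M ⟶ N) := ⟨fun f => ⟨-f.lin, by simp [f.comm]⟩⟩
instance (M N : RMod k A) : Sub (M ⟶ N) := ⟨fun f g => ⟨f.lin - g.lin, by simp [f.comm, g.comm]⟩⟩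
instance (M N : RMod k A) : SMul k (M ⟶ N) := ⟨fun c f => ⟨c • f.lin, by simp [f.comm]⟩⟩
instance (M N : RMod k A) : SMul ℕ (M ⟶ N) := ⟨fun c f => ⟨c • f.lin, by simp [f.comm]⟩⟩
instance (M N : RMod k A) : SMul ℤ (M ⟶ N) := ⟨fun c f => ⟨c • f.lin, by simp [f.comm]⟩⟩

instance (M N : RMod k A) : AddCommGroup (M ⟶ N) :=
  (lin_injective M N).addCommGroup _ rfl (fun _ _ => rfl) (fun _ => rfl) (fun _ _ => rfl)
    (fun _ _ => rfl) (fun _ _ => rfl)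

/-- The forgetful map from morphisms to linear maps. -/
def linHom (M N : RMod k A) : (M ⟶ N) →+ (M →ₗ[k] N) where
  toFun f := f.lin
  map_zero' := rfl
  map_add' _ _ := rfl

instance (M N : RMod k A) : Module k (M ⟶ N) :=
  (lin_injective M N).module k (linHom M N) (fun _ _ => rfl)

@[simp] theorem add_lin {M N : RMod k A} (f g : M ⟶ N) : Hom.lin (f + g) = f.lin + g.lin := rfl
@[simp] theorem smul_lin {M N : RMod k A} (c : k) (f : M ⟶ N) : Hom.lin (c • f) = c • f.lin := rfl

instance : Preadditive (RMod k A) where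
  add_comp _ _ _ f f' g := hom_ext (by simp [LinearMap.comp_add])
  comp_add _ _ _ f g g' := hom_ext (by simp [LinearMap.add_comp])

instance : Linear k (RMod k A) where
  smul_comp _ _ _ c f g := hom_ext (by simp [LinearMap.comp_smul])
  comp_smul _ _ _ f c g := hom_ext (by simp [LinearMap.smul_comp])

/-- An isomorphism of modules from an equivariant linear equivalence. -/
def isoMk {M N : RMod k A} (f : M ⟶ N) (g : N →ₗ[k] M) (h₁ : g ∘ₗ f.lin = LinearMap.id)
    (h₂ : f.lin ∘ₗ g = LinearMap.id) : M ≅ N where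
  hom := f
  inv := ⟨g, fun a m => by
    have e₁ : ∀ x, g (f.lin x) = x := fun x => LinearMap.congr_fun h₁ x
    have e₂ : ∀ x, f.lin (g x) = x := fun x => LinearMap.congr_fun h₂ x
    rw [← e₁ (M.act a (g m)), f.comm, e₂]⟩
  hom_inv_id := hom_ext h₁
  inv_hom_id := hom_ext h₂

@[simp] theorem isoMk_hom {M N : RMod k A} (f : M ⟶ N) (g : N →ₗ[k] M) (h₁ h₂) :
    (isoMk f g h₁ h₂).hom = f := rfl

end Cat

/-! ### The tensor product of right modules over a weak Hopf algebra -/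

section Tensor

variable {k A : Type u} [Field k] [Ring A] [Algebra k A]

/-- The right action of `A ⊗ A` on `M ⊗ N`: `(m ⊗ n).(a ⊗ b) = m.a ⊗ n.b`. -/
noncomputable def pairAct (M N : RMod k A) : A ⊗[k] A →ₗ[k] (M ⊗[k] N) →ₗ[k] (M ⊗[k] N) :=
  TensorProduct.homTensorHomMap (RingHom.id k) M N M N ∘ₗ TensorProduct.map M.act N.act

@[simp] theorem pairAct_tmul (M N : RMod k A) (a b : A) (m : M) (n : N) :
    pairAct M N (a ⊗ₜ b) (m ⊗ₜ n) = M.act a m ⊗ₜ N.act b n := rfl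

theorem pairAct_mul (M N : RMod k A) (x y : A ⊗[k] A) (w : M ⊗[k] N) :
    pairAct M N (x * y) w = pairAct M N y (pairAct M N x w) := by
  induction w with
  | zero => simp
  | add u v hu hv => simp only [map_add, hu, hv]
  | tmul m n =>
    induction x with
    | zero => simp
    | add u v hu hv => simp only [map_add, add_mul, LinearMap.add_apply, hu, hv]
    | tmul a b =>
      induction y with
      | zero => simp
      | add u v hu hv => simp only [map_add, mul_add, LinearMap.add_apply, hu, hv]
      | tmul c d => simp [act_mul]

theorem pairAct_map {M N M' N' : RMod k A} (f : M ⟶ M') (g : N ⟶ N') (x : A ⊗[k] A)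
    (w : M ⊗[k] N) : TensorProduct.map f.lin g.lin (pairAct M N x w) =
      pairAct M' N' x (TensorProduct.map f.lin g.lin w) := by
  induction w with
  | zero => simp
  | add u v hu hv => simp only [map_add, hu, hv]
  | tmul m n =>
    induction x with
    | zero => simp
    | add u v hu hv => simp only [map_add, LinearMap.add_apply, hu, hv]
    | tmul a b => simp [f.comm, g.comm]

variable [Coalgebra k A]

/-- The subspace `M ⊗̄ N = (M ⊗ N)Δ(1)` of `M ⊗ N`. -/
noncomputable def tens (M N : RMod k A) : Submodule k (M ⊗[k] N) :=
  LinearMap.range (pairAct M N (comul (R := k) (1 : A)))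

variable [WeakHopfAlgebra k A]

theorem pairAct_mem_tens (M N : RMod k A) (a : A) (w : M ⊗[k] N) :
    pairAct M N (comul (R := k) a) w ∈ tens M N :=
  ⟨pairAct M N (comul (R := k) a) w, by rw [← pairAct_mul, comul_mul_one]⟩

theorem pairAct_of_mem_tens (M N : RMod k A) {w : M ⊗[k] N} (h : w ∈ tens M N) :
    pairAct M N (comul (R := k) (1 : A)) w = w := by
  obtain ⟨v, rfl⟩ := h
  rw [← pairAct_mul, comul_one_mul]

/-- The tensor product `M ⊗̄ N = (M ⊗ N)Δ(1)`, with `A` acting through the coproduct: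
`w.a = w.Δ(a)`. -/
noncomputable def tensorObj (M N : RMod k A) : RMod k A where
  carrier := tens M N
  act := LinearMap.mk₂ k
    (fun a x => ⟨pairAct M N (comul (R := k) a) x.1, pairAct_mem_tens M N a x.1⟩)
    (fun _ _ _ => Subtype.ext (by simp)) (fun _ _ _ => Subtype.ext (by simp))
    (fun _ _ _ => Subtype.ext (by simp)) (fun _ _ _ => Subtype.ext (by simp))
  act_one x := Subtype.ext (pairAct_of_mem_tens M N x.2)
  act_mul a b x := Subtype.ext (by
    simp only [LinearMap.mk₂_apply, ← pairAct_mul, WeakHopfAlgebra.comul_mul])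

/-- The inclusion `M ⊗̄ N ⊆ M ⊗ N`. -/
noncomputable def incl (M N : RMod k A) : tensorObj M N →ₗ[k] M ⊗[k] N := (tens M N).subtype

/-- The map `M ⊗ N → M ⊗̄ N`, `w ↦ w.Δ(1)`. -/
noncomputable def proj (M N : RMod k A) : M ⊗[k] N →ₗ[k] tensorObj M N :=
  (pairAct M N (comul (R := k) (1 : A))).rangeRestrict

theorem incl_injective (M N : RMod k A) : Function.Injective (incl M N) :=
  Subtype.coe_injective

theorem incl_proj (M N : RMod k A) (w : M ⊗[k] N) :
    incl M N (proj M N w) = pairAct M N (comul (R := k) (1 : A)) w := rfl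

/-- The action on `M ⊗̄ N` is the action through `Δ` on the subspace. -/
theorem incl_act (M N : RMod k A) (a : A) (x : tensorObj M N) :
    incl M N ((tensorObj M N).act a x) = pairAct M N (comul (R := k) a) (incl M N x) := rfl

theorem proj_incl (M N : RMod k A) (x : tensorObj M N) : proj M N (incl M N x) = x := by
  apply incl_injective
  rw [incl_proj]
  exact pairAct_of_mem_tens M N x.2

theorem proj_surjective (M N : RMod k A) : Function.Surjective (proj M N) :=
  fun x => ⟨_, proj_incl M N x⟩

theorem proj_pairAct_comul_one (M N : RMod k A) (w : M ⊗[k] N) :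
    proj M N (pairAct M N (comul (R := k) (1 : A)) w) = proj M N w := by
  rw [← incl_proj, proj_incl]

theorem act_proj (M N : RMod k A) (a : A) (w : M ⊗[k] N) :
    (tensorObj M N).act a (proj M N w) = proj M N (pairAct M N (comul (R := k) a) w) := by
  apply incl_injective
  rw [incl_act, incl_proj, incl_proj, ← pairAct_mul, ← pairAct_mul, comul_one_mul, comul_mul_one]

theorem tens_ext {M N : RMod k A} {X : Type*} [AddCommMonoid X] [Module k X]
    {f g : tensorObj M N →ₗ[k] X} (h : ∀ m n, f (proj M N (m ⊗ₜ n)) = g (proj M N (m ⊗ₜ n))) :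
    f = g := by
  have : f ∘ₗ proj M N = g ∘ₗ proj M N := TensorProduct.ext' h
  ext x
  obtain ⟨w, rfl⟩ := proj_surjective M N x
  exact LinearMap.congr_fun this w

/-- The tensor product of two morphisms: the restriction of `f ⊗ g`. -/
noncomputable def tensorMap {M N M' N' : RMod k A} (f : M ⟶ M') (g : N ⟶ N') :
    tensorObj M N ⟶ tensorObj M' N' where
  lin := proj M' N' ∘ₗ TensorProduct.map f.lin g.lin ∘ₗ incl M N
  comm a x := by
    simp only [LinearMap.comp_apply]
    rw [incl_act, act_proj, pairAct_map]

theorem tensorMap_proj {M N M' N' : RMod k A} (f : M ⟶ M') (g : N ⟶ N') (w : M ⊗[k] N) :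
    (tensorMap f g).lin (proj M N w) = proj M' N' (TensorProduct.map f.lin g.lin w) := by
  simp only [tensorMap, LinearMap.comp_apply]
  rw [incl_proj, pairAct_map, proj_pairAct_comul_one]

@[simp] theorem tensorMap_proj_tmul {M N M' N' : RMod k A} (f : M ⟶ M') (g : N ⟶ N') (m : M)
    (n : N) : (tensorMap f g).lin (proj M N (m ⊗ₜ n)) = proj M' N' (f.lin m ⊗ₜ g.lin n) := by
  rw [tensorMap_proj, TensorProduct.map_tmul]

/-- The associator: the restriction of `(M ⊗ N) ⊗ P → M ⊗ (N ⊗ P)`. -/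
noncomputable def assocLin (M N P : RMod k A) :
    tensorObj (tensorObj M N) P →ₗ[k] tensorObj M (tensorObj N P) :=
  proj M (tensorObj N P) ∘ₗ (proj N P).lTensor M ∘ₗ
    (TensorProduct.assoc k M N P).toLinearMap ∘ₗ (incl M N).rTensor P ∘ₗ incl (tensorObj M N) P

/-- The inverse associator. -/
noncomputable def assocInvLin (M N P : RMod k A) :
    tensorObj M (tensorObj N P) →ₗ[k] tensorObj (tensorObj M N) P :=
  proj (tensorObj M N) P ∘ₗ (proj M N).rTensor P ∘ₗ
    (TensorProduct.assoc k M N P).symm.toLinearMap ∘ₗ (incl N P).lTensor M ∘ₗ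
      incl M (tensorObj N P)

/-- The class of `m ⊗ n ⊗ p` in `(M ⊗̄ N) ⊗̄ P`. -/
noncomputable def gen₁ (M N P : RMod k A) :
    M ⊗[k] (N ⊗[k] P) →ₗ[k] tensorObj (tensorObj M N) P :=
  proj (tensorObj M N) P ∘ₗ (proj M N).rTensor P ∘ₗ (TensorProduct.assoc k M N P).symm.toLinearMap

/-- The class of `m ⊗ n ⊗ p` in `M ⊗̄ (N ⊗̄ P)`. -/
noncomputable def gen₂ (M N P : RMod k A) :
    M ⊗[k] (N ⊗[k] P) →ₗ[k] tensorObj M (tensorObj N P) :=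
  proj M (tensorObj N P) ∘ₗ (proj N P).lTensor M

@[simp] theorem gen₁_tmul (M N P : RMod k A) (m : M) (n : N) (p : P) :
    gen₁ M N P (m ⊗ₜ (n ⊗ₜ p)) = proj (tensorObj M N) P (proj M N (m ⊗ₜ n) ⊗ₜ p) := rfl

@[simp] theorem gen₂_tmul (M N P : RMod k A) (m : M) (n : N) (p : P) :
    gen₂ M N P (m ⊗ₜ (n ⊗ₜ p)) = proj M (tensorObj N P) (m ⊗ₜ proj N P (n ⊗ₜ p)) := rfl

/-- The action of `A ⊗ (A ⊗ A)` on `M ⊗ (N ⊗ P)`. -/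
noncomputable def tripleAct (M N P : RMod k A) :
    A ⊗[k] (A ⊗[k] A) →ₗ[k] (M ⊗[k] (N ⊗[k] P)) →ₗ[k] (M ⊗[k] (N ⊗[k] P)) :=
  TensorProduct.homTensorHomMap (RingHom.id k) M (N ⊗[k] P) M (N ⊗[k] P) ∘ₗ
    TensorProduct.map M.act (pairAct N P)

/-- The triple coproduct `(id ⊗ Δ)Δ(a)`. -/
noncomputable def comul₃ (k : Type*) {A : Type*} [Field k] [Ring A] [Algebra k A] [Coalgebra k A]
    (a : A) : A ⊗[k] (A ⊗[k] A) :=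
  (comul (R := k) (A := A)).lTensor A (comul (R := k) a)

theorem comul₃_eq_left {ι : Type*} {a : A} (r : Repr k a ι) :
    comul₃ k a = ∑ i ∈ r.index,
      TensorProduct.assoc k A A A (comul (R := k) (r.left i) ⊗ₜ[k] r.right i) := by
  rw [coassoc_repr, comul₃, ← r.eq]; simp

theorem comul₃_eq_right {ι : Type*} {a : A} (r : Repr k a ι) :
    comul₃ k a = ∑ i ∈ r.index, r.left i ⊗ₜ[k] comul (R := k) (r.right i) := by
  rw [comul₃, ← r.eq]; simp

theorem tripleAct_assoc (M N P : RMod k A) (X : A ⊗[k] A) (c : A) (m : M) (n : N) (p : P) :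
    tripleAct M N P (TensorProduct.assoc k A A A (X ⊗ₜ c)) (m ⊗ₜ (n ⊗ₜ p)) =
      TensorProduct.assoc k M N P (pairAct M N X (m ⊗ₜ n) ⊗ₜ P.act c p) := by
  induction X with
  | zero => simp
  | tmul u v => rfl
  | add u v hu hv => simp only [TensorProduct.add_tmul, map_add, LinearMap.add_apply, hu, hv]

theorem gen₁_assoc (M N P : RMod k A) (w : M ⊗[k] N) (p : P) :
    gen₁ M N P (TensorProduct.assoc k M N P (w ⊗ₜ p)) =
      proj (tensorObj M N) P (proj M N w ⊗ₜ p) := by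
  simp [gen₁]

theorem gen₂_tmul' (M N P : RMod k A) (w : N ⊗[k] P) (m : M) :
    gen₂ M N P (m ⊗ₜ w) = proj M (tensorObj N P) (m ⊗ₜ proj N P w) := rfl

theorem act_gen₁ (M N P : RMod k A) (a : A) (w : M ⊗[k] (N ⊗[k] P)) :
    (tensorObj (tensorObj M N) P).act a (gen₁ M N P w) =
      gen₁ M N P (tripleAct M N P (comul₃ k a) w) := by
  suffices h : (tensorObj (tensorObj M N) P).act a ∘ₗ gen₁ M N P =
      gen₁ M N P ∘ₗ tripleAct M N P (comul₃ k a) from LinearMap.congr_fun h w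
  refine TensorProduct.ext_threefold' fun m n p => ?_
  simp only [LinearMap.comp_apply, gen₁_tmul, act_proj,
    comul₃_eq_left (Repr.arbitrary k a), map_sum, LinearMap.sum_apply, tripleAct_assoc, gen₁_assoc]
  conv_lhs => rw [← (Repr.arbitrary k a).eq]
  simp [act_proj]

theorem act_gen₂ (M N P : RMod k A) (a : A) (w : M ⊗[k] (N ⊗[k] P)) :
    (tensorObj M (tensorObj N P)).act a (gen₂ M N P w) =
      gen₂ M N P (tripleAct M N P (comul₃ k a) w) := by
  suffices h : (tensorObj M (tensorObj N P)).act a ∘ₗ gen₂ M N P =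
      gen₂ M N P ∘ₗ tripleAct M N P (comul₃ k a) from LinearMap.congr_fun h w
  refine TensorProduct.ext_threefold' fun m n p => ?_
  simp only [LinearMap.comp_apply, gen₂_tmul, act_proj, comul₃_eq_right (Repr.arbitrary k a)]
  conv_lhs => rw [← (Repr.arbitrary k a).eq]
  simp [act_proj, tripleAct, gen₂_tmul']

theorem gen₁_surjective (M N P : RMod k A) : Function.Surjective (gen₁ M N P) :=
  (proj_surjective _ _).comp ((LinearMap.rTensor_surjective _ (proj_surjective M N)).comp
    (TensorProduct.assoc k M N P).symm.surjective)

theorem gen₂_surjective (M N P : RMod k A) : Function.Surjective (gen₂ M N P) :=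
  (proj_surjective _ _).comp (LinearMap.lTensor_surjective _ (proj_surjective N P))

theorem assocLin_gen (M N P : RMod k A) (w : M ⊗[k] (N ⊗[k] P)) :
    assocLin M N P (gen₁ M N P w) = gen₂ M N P w := by
  have h : assocLin M N P ∘ₗ gen₁ M N P = gen₂ M N P ∘ₗ tripleAct M N P (comul₃ k 1) := by
    refine TensorProduct.ext_threefold' fun m n p => ?_
    simp only [LinearMap.comp_apply, gen₁_tmul, comul₃_eq_left (Repr.arbitrary k (1 : A)), map_sum,
      LinearMap.sum_apply, tripleAct_assoc, assocLin, incl_proj]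
    conv_lhs => rw [← (Repr.arbitrary k (1 : A)).eq]
    simp [incl_act, incl_proj, ← pairAct_mul, comul_one_mul, gen₂]
  have h' := LinearMap.congr_fun h w
  simp only [LinearMap.comp_apply] at h'
  rw [h', ← act_gen₂, act_one]

theorem assocInvLin_gen (M N P : RMod k A) (w : M ⊗[k] (N ⊗[k] P)) :
    assocInvLin M N P (gen₂ M N P w) = gen₁ M N P w := by
  have h : assocInvLin M N P ∘ₗ gen₂ M N P = gen₁ M N P ∘ₗ tripleAct M N P (comul₃ k 1) := by
    refine TensorProduct.ext_threefold' fun m n p => ?_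
    simp only [LinearMap.comp_apply, gen₂_tmul, comul₃_eq_right (Repr.arbitrary k (1 : A)), map_sum,
      LinearMap.sum_apply, assocInvLin, incl_proj]
    conv_lhs => rw [← (Repr.arbitrary k (1 : A)).eq]
    simp [incl_act, incl_proj, ← pairAct_mul, comul_one_mul, gen₁, tripleAct]
  have h' := LinearMap.congr_fun h w
  simp only [LinearMap.comp_apply] at h'
  rw [h', ← act_gen₁, act_one]

/-- The associativity isomorphism `(M ⊗̄ N) ⊗̄ P ≅ M ⊗̄ (N ⊗̄ P)`. -/
noncomputable def assocIso (M N P : RMod k A) :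
    tensorObj (tensorObj M N) P ≅ tensorObj M (tensorObj N P) :=
  isoMk ⟨assocLin M N P, fun a x => by
      obtain ⟨w, rfl⟩ := gen₁_surjective M N P x
      rw [act_gen₁, assocLin_gen, assocLin_gen, act_gen₂]⟩
    (assocInvLin M N P)
    (by
      ext x
      obtain ⟨w, rfl⟩ := gen₁_surjective M N P x
      simp [assocLin_gen, assocInvLin_gen])
    (by
      ext x
      obtain ⟨w, rfl⟩ := gen₂_surjective M N P x
      simp [assocLin_gen, assocInvLin_gen])

@[simp] theorem assocIso_hom_gen (M N P : RMod k A) (m : M) (n : N) (p : P) :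
    (assocIso M N P).hom.lin (proj (tensorObj M N) P (proj M N (m ⊗ₜ n) ⊗ₜ p)) =
      proj M (tensorObj N P) (m ⊗ₜ proj N P (n ⊗ₜ p)) :=
  assocLin_gen M N P (m ⊗ₜ (n ⊗ₜ p))

theorem tens_ext₃ {M N P : RMod k A} {X : Type*} [AddCommMonoid X] [Module k X]
    {f g : tensorObj (tensorObj M N) P →ₗ[k] X}
    (h : ∀ m n p, f (proj (tensorObj M N) P (proj M N (m ⊗ₜ n) ⊗ₜ p)) =
      g (proj (tensorObj M N) P (proj M N (m ⊗ₜ n) ⊗ₜ p))) :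
    f = g := by
  have : f ∘ₗ gen₁ M N P = g ∘ₗ gen₁ M N P := TensorProduct.ext_threefold' h
  ext x
  obtain ⟨w, rfl⟩ := gen₁_surjective M N P x
  exact LinearMap.congr_fun this w

theorem tens_ext₄ {M N P Q : RMod k A} {X : Type*} [AddCommMonoid X] [Module k X]
    {f g : tensorObj (tensorObj (tensorObj M N) P) Q →ₗ[k] X}
    (h : ∀ m n p q,
      f (proj _ Q (proj (tensorObj M N) P (proj M N (m ⊗ₜ n) ⊗ₜ p) ⊗ₜ q)) =
      g (proj _ Q (proj (tensorObj M N) P (proj M N (m ⊗ₜ n) ⊗ₜ p) ⊗ₜ q))) :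
    f = g := by
  refine tens_ext fun x q => ?_
  have : (f ∘ₗ proj _ Q) ∘ₗ (TensorProduct.mk k _ Q).flip q =
      (g ∘ₗ proj _ Q) ∘ₗ (TensorProduct.mk k _ Q).flip q :=
    tens_ext₃ fun m n p => h m n p q
  exact LinearMap.congr_fun this x

end Tensor

section Unit

variable {k A : Type u} [Field k] [Ring A] [Algebra k A] [Coalgebra k A] [WeakHopfAlgebra k A]

variable (k A) in
/-- The tensor unit: the source counital subalgebra `A_s = ε_s(A)`, with `z.a = ε_s(za)`. -/
noncomputable def unitObj : RMod k A where
  carrier := LinearMap.range (counitS k A)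
  act := LinearMap.mk₂ k (fun a z => (counitS k A).rangeRestrict (z.1 * a))
    (fun _ _ _ => by simp [mul_add]) (fun _ _ _ => by simp)
    (fun _ _ _ => by simp [add_mul]) (fun _ _ _ => by simp)
  act_one := by
    rintro ⟨_, x, rfl⟩
    exact Subtype.ext (by simp [counitS_counitS])
  act_mul a b z := Subtype.ext (by
    simp [counitS_counitS_mul, mul_assoc])

variable (k A) in
/-- The inclusion `A_s ⊆ A`. -/
noncomputable def unitIncl : unitObj k A →ₗ[k] A := (LinearMap.range (counitS k A)).subtype

variable (k A) in
/-- The projection `ε_s : A → A_s`. -/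
noncomputable def unitProj : A →ₗ[k] unitObj k A := (counitS k A).rangeRestrict

theorem unitIncl_injective : Function.Injective (unitIncl k A) := Subtype.coe_injective

theorem unitIncl_proj (a : A) : unitIncl k A (unitProj k A a) = counitS k A a := rfl

theorem counitS_unitIncl (z : unitObj k A) : counitS k A (unitIncl k A z) = unitIncl k A z := by
  obtain ⟨_, x, rfl⟩ := z
  exact counitS_counitS x

theorem unitProj_incl (z : unitObj k A) : unitProj k A (unitIncl k A z) = z :=
  unitIncl_injective (counitS_unitIncl z)

theorem unitProj_counitS (a : A) : unitProj k A (counitS k A a) = unitProj k A a :=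
  unitProj_incl (unitProj k A a)

theorem unit_act (a : A) (z : unitObj k A) :
    (unitObj k A).act a z = unitProj k A (unitIncl k A z * a) := rfl

/-- The left unit constraint `A_s ⊗̄ M → M`: the restriction of `ε ⊗ id`. -/
noncomputable def leftLin (M : RMod k A) : tensorObj (unitObj k A) M →ₗ[k] M :=
  (TensorProduct.lid k M).toLinearMap ∘ₗ
    (counit (R := k) ∘ₗ unitIncl k A).rTensor M ∘ₗ incl (unitObj k A) M

/-- The right unit constraint `M ⊗̄ A_s → M`: the restriction of `id ⊗ ε`. -/
noncomputable def rightLin (M : RMod k A) : tensorObj M (unitObj k A) →ₗ[k] M :=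
  (TensorProduct.rid k M).toLinearMap ∘ₗ
    (counit (R := k) ∘ₗ unitIncl k A).lTensor M ∘ₗ incl M (unitObj k A)

/-- The inverse `m ↦ (1 ⊗ m)Δ(1)` of the left unit constraint. -/
noncomputable def leftInv (M : RMod k A) : M →ₗ[k] tensorObj (unitObj k A) M :=
  proj (unitObj k A) M ∘ₗ TensorProduct.mk k (unitObj k A) M (unitProj k A 1)

/-- The inverse `m ↦ (m ⊗ 1)Δ(1)` of the right unit constraint. -/
noncomputable def rightInv (M : RMod k A) : M →ₗ[k] tensorObj M (unitObj k A) :=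
  proj M (unitObj k A) ∘ₗ (TensorProduct.mk k M (unitObj k A)).flip (unitProj k A 1)

theorem counit_pairAct_left (M : RMod k A) (X : A ⊗[k] A) (z : unitObj k A) (m : M) :
    TensorProduct.lid k M ((counit (R := k) ∘ₗ unitIncl k A).rTensor M
      (pairAct (unitObj k A) M X (z ⊗ₜ m))) = M.act (conL (epsL k (unitIncl k A z)) X) m := by
  induction X with
  | zero => simp
  | add u v hu hv => simp only [map_add, LinearMap.add_apply, hu, hv]
  | tmul a b => simp [unit_act, unitIncl_proj, counit_counitS]

theorem counit_pairAct_right (M : RMod k A) (X : A ⊗[k] A) (z : unitObj k A) (m : M) :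
    TensorProduct.rid k M ((counit (R := k) ∘ₗ unitIncl k A).lTensor M
      (pairAct M (unitObj k A) X (m ⊗ₜ z))) = M.act (conR (epsL k (unitIncl k A z)) X) m := by
  induction X with
  | zero => simp
  | add u v hu hv => simp only [map_add, LinearMap.add_apply, hu, hv]
  | tmul a b => simp [unit_act, unitIncl_proj, counit_counitS]

theorem leftLin_proj (M : RMod k A) (z : unitObj k A) (m : M) :
    leftLin M (proj (unitObj k A) M (z ⊗ₜ m)) =
      M.act (conL (epsL k (unitIncl k A z)) (comul (R := k) 1)) m := by
  simp only [leftLin, LinearMap.comp_apply, incl_proj]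
  exact counit_pairAct_left M _ z m

theorem rightLin_proj (M : RMod k A) (z : unitObj k A) (m : M) :
    rightLin M (proj M (unitObj k A) (m ⊗ₜ z)) = M.act (unitIncl k A z) m := by
  simp only [rightLin, LinearMap.comp_apply, incl_proj]
  refine (counit_pairAct_right M _ z m).trans ?_
  rw [← counitS_eq, counitS_unitIncl]

/-- The left unit constraint as a morphism. -/
noncomputable def leftHom (M : RMod k A) : tensorObj (unitObj k A) M ⟶ M where
  lin := leftLin M
  comm a x := by
    suffices h : leftLin M ∘ₗ (tensorObj (unitObj k A) M).act a = M.act a ∘ₗ leftLin M from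
      LinearMap.congr_fun h x
    refine tens_ext fun z m => ?_
    simp only [LinearMap.comp_apply]
    rw [leftLin_proj, ← act_mul, ← conL_epsL_comul, leftLin]
    simp only [LinearMap.comp_apply, incl_act, incl_proj, ← pairAct_mul, comul_one_mul]
    exact counit_pairAct_left M _ z m

/-- The right unit constraint as a morphism. -/
noncomputable def rightHom (M : RMod k A) : tensorObj M (unitObj k A) ⟶ M where
  lin := rightLin M
  comm a x := by
    suffices h : rightLin M ∘ₗ (tensorObj M (unitObj k A)).act a = M.act a ∘ₗ rightLin M from
      LinearMap.congr_fun h x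
    refine tens_ext fun m z => ?_
    simp only [LinearMap.comp_apply]
    rw [rightLin_proj, ← act_mul, ← counitS_unitIncl z, counitS_mul, rightLin]
    simp only [LinearMap.comp_apply, incl_act, incl_proj, ← pairAct_mul, comul_one_mul]
    exact counit_pairAct_right M _ z m

/-- `(z ⊗ m).X` computed in `A_s ⊗ M`. -/
theorem pairAct_unit_left (M : RMod k A) (X : A ⊗[k] A) (z : unitObj k A) (m : M) :
    pairAct (unitObj k A) M X (z ⊗ₜ m) = TensorProduct.map (unitProj k A) (M.act.flip m)
      ((unitIncl k A z ⊗ₜ[k] (1 : A)) * X) := by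
  induction X with
  | zero => simp
  | add u v hu hv => simp only [map_add, LinearMap.add_apply, hu, hv, mul_add]
  | tmul a b => simp [unit_act]

theorem pairAct_unit_right (M : RMod k A) (X : A ⊗[k] A) (z : unitObj k A) (m : M) :
    pairAct M (unitObj k A) X (m ⊗ₜ z) = TensorProduct.map (M.act.flip m) (unitProj k A)
      (((1 : A) ⊗ₜ[k] unitIncl k A z) * X) := by
  induction X with
  | zero => simp
  | add u v hu hv => simp only [map_add, LinearMap.add_apply, hu, hv, mul_add]
  | tmul a b => simp [unit_act]

theorem pairAct_eq_map (M N : RMod k A) (X : A ⊗[k] A) (m : M) (n : N) :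
    pairAct M N X (m ⊗ₜ n) = TensorProduct.map (M.act.flip m) (N.act.flip n) X := by
  induction X with
  | zero => simp
  | add u v hu hv => simp only [map_add, LinearMap.add_apply, hu, hv]
  | tmul a b => simp

theorem unitIncl_one : unitIncl k A (unitProj k A 1) = 1 := by
  rw [unitIncl_proj, counitS_one]

/-- The isomorphism `A_s ⊗̄ M ≅ M`. -/
noncomputable def leftIso (M : RMod k A) : tensorObj (unitObj k A) M ≅ M :=
  isoMk (leftHom M) (leftInv M)
    (by
      refine tens_ext fun z m => ?_
      change leftInv M (leftLin M (proj (unitObj k A) M (z ⊗ₜ m))) = proj (unitObj k A) M (z ⊗ₜ m)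
      rw [leftLin_proj, leftInv]
      apply incl_injective
      simp only [LinearMap.comp_apply, TensorProduct.mk_apply, incl_proj, pairAct_unit_left]
      have h := congrArg (TensorProduct.map (unitProj k A) (M.act.flip m))
        (conL_mul_comul_one (k := k) (unitIncl k A z))
      rw [← LinearMap.comp_apply (TensorProduct.map _ _), LinearMap.map_comp_rTensor,
        show unitProj k A ∘ₗ counitS k A = unitProj k A from LinearMap.ext unitProj_counitS] at h
      rw [← h, unitIncl_one]
      generalize conL (epsL k (unitIncl k A z)) (comul (R := k) 1) = w
      generalize comul (R := k) (1 : A) = X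
      induction X with
      | zero => simp
      | add u v hu hv => simp only [map_add, hu, hv, mul_add]
      | tmul a b => simp [act_mul])
    (by
      ext m
      change leftLin M (proj (unitObj k A) M (unitProj k A 1 ⊗ₜ m)) = m
      rw [leftLin_proj, unitIncl_one,
        show epsL k (1 : A) = counit (R := k) by ext; simp, conL_counit_comul, act_one])

/-- The isomorphism `M ⊗̄ A_s ≅ M`. -/
noncomputable def rightIso (M : RMod k A) : tensorObj M (unitObj k A) ≅ M :=
  isoMk (rightHom M) (rightInv M)
    (by
      refine tens_ext fun m z => ?_
      change rightInv M (rightLin M (proj M (unitObj k A) (m ⊗ₜ z))) = proj M (unitObj k A) (m ⊗ₜ z)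
      rw [rightLin_proj, rightInv]
      apply incl_injective
      simp only [LinearMap.comp_apply, LinearMap.flip_apply, TensorProduct.mk_apply, incl_proj,
        pairAct_unit_right]
      have h := congrArg (TensorProduct.map (M.act.flip m) (unitProj k A))
        (counitS_lTensor_mul_comul (k := k) (unitIncl k A z))
      rw [← LinearMap.comp_apply (TensorProduct.map _ _),
        ← LinearMap.comp_apply (TensorProduct.map _ _), LinearMap.map_comp_lTensor,
        show unitProj k A ∘ₗ counitS k A = unitProj k A from LinearMap.ext unitProj_counitS] at h
      have h2 := comul_counitS (k := k) (unitIncl k A z)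
      rw [counitS_unitIncl] at h2
      rw [← h2, ← h, unitIncl_one]
      generalize comul (R := k) (1 : A) = X
      induction X with
      | zero => simp
      | add u v hu hv => simp only [map_add, hu, hv, mul_add]
      | tmul a b => simp [act_mul])
    (by
      ext m
      change rightLin M (proj M (unitObj k A) (m ⊗ₜ unitProj k A 1)) = m
      rw [rightLin_proj, unitIncl_one, act_one])

@[simp] theorem leftIso_hom_proj (M : RMod k A) (z : unitObj k A) (m : M) :
    (leftIso M).hom.lin (proj (unitObj k A) M (z ⊗ₜ m)) =
      M.act (conL (epsL k (unitIncl k A z)) (comul (R := k) 1)) m := leftLin_proj M z m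

@[simp] theorem rightIso_hom_proj (M : RMod k A) (z : unitObj k A) (m : M) :
    (rightIso M).hom.lin (proj M (unitObj k A) (m ⊗ₜ z)) = M.act (unitIncl k A z) m :=
  rightLin_proj M z m

theorem proj_triangle (M N : RMod k A) (m : M) (z : unitObj k A) (n : N) :
    proj M N (m ⊗ₜ N.act (conL (epsL k (unitIncl k A z)) (comul (R := k) 1)) n) =
      proj M N (M.act (unitIncl k A z) m ⊗ₜ n) := by
  apply incl_injective
  have h := (conL_mul_comul_one (k := k) (unitIncl k A z)).trans
    ((counitS_unitIncl z ▸ counitS_rTensor_mul_comul (k := k) (unitIncl k A z)))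
  have h2 := congrArg (fun X => pairAct M N X (m ⊗ₜ n)) h
  simpa only [pairAct_mul, pairAct_tmul, act_one, incl_proj] using h2

/-- The tensor category of right modules over a weak Hopf algebra. -/
noncomputable instance : MonoidalCategoryStruct (RMod k A) where
  tensorObj := tensorObj
  whiskerLeft M _ _ f := tensorMap (𝟙 M) f
  whiskerRight f N := tensorMap f (𝟙 N)
  tensorHom := tensorMap
  tensorUnit := unitObj k A
  associator := assocIso
  leftUnitor := leftIso
  rightUnitor := rightIso

noncomputable instance : MonoidalCategory (RMod k A) :=
  MonoidalCategory.ofTensorHom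
    (fun M N => hom_ext (tens_ext fun m n => tensorMap_proj_tmul (𝟙 M) (𝟙 N) m n))
    (fun _ _ _ _ => rfl) (fun _ _ => rfl)
    (fun {M₁ N₁ P₁ M₂ N₂ P₂} f₁ f₂ g₁ g₂ => hom_ext (tens_ext fun m n => by
      change (tensorMap g₁ g₂).lin ((tensorMap f₁ f₂).lin _) = (tensorMap (f₁ ≫ g₁) (f₂ ≫ g₂)).lin _
      simp))
    (fun {M₁ M₂ M₃ N₁ N₂ N₃} f₁ f₂ f₃ => hom_ext (tens_ext₃ fun m n p => by
      change (assocIso N₁ N₂ N₃).hom.lin ((tensorMap (tensorMap f₁ f₂) f₃).lin _) =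
        (tensorMap f₁ (tensorMap f₂ f₃)).lin ((assocIso M₁ M₂ M₃).hom.lin _)
      simp))
    (fun {M N} f => hom_ext (tens_ext fun (z : unitObj k A) m => by
      change (leftIso N).hom.lin ((tensorMap (𝟙 (unitObj k A)) f).lin
        (proj (unitObj k A) M (z ⊗ₜ m))) =
        f.lin ((leftIso M).hom.lin (proj (unitObj k A) M (z ⊗ₜ m)))
      simp [f.comm]))
    (fun {M N} f => hom_ext (tens_ext fun m (z : unitObj k A) => by
      change (rightIso N).hom.lin ((tensorMap f (𝟙 (unitObj k A))).lin
        (proj M (unitObj k A) (m ⊗ₜ z))) =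
        f.lin ((rightIso M).hom.lin (proj M (unitObj k A) (m ⊗ₜ z)))
      simp [f.comm]))
    (fun M N P Q => hom_ext (tens_ext₄ fun m n p q => by
      change (tensorMap (𝟙 M) (assocIso N P Q).hom).lin
        ((assocIso M (tensorObj N P) Q).hom.lin
          ((tensorMap (assocIso M N P).hom (𝟙 Q)).lin _)) =
        (assocIso M N (tensorObj P Q)).hom.lin ((assocIso (tensorObj M N) P Q).hom.lin _)
      simp))
    (fun M N => hom_ext (tens_ext₃ fun m (z : unitObj k A) n => by
      change (tensorMap (𝟙 M) (leftIso N).hom).lin ((assocIso M (unitObj k A) N).hom.lin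
        (proj _ N (proj M (unitObj k A) (m ⊗ₜ z) ⊗ₜ n))) =
        (tensorMap (rightIso M).hom (𝟙 N)).lin (proj _ N (proj M (unitObj k A) (m ⊗ₜ z) ⊗ₜ n))
      simp [proj_triangle]))

end Unit
section HopfCase

variable {k A : Type u} [Field k] [Ring A] [HopfAlgebra k A]

/-- For a Hopf algebra, `M ⊗̄ N` is all of `M ⊗ N`. -/
theorem tens_eq_top (M N : RMod k A) : tens M N = ⊤ := by
  have h : pairAct M N (comul (R := k) (1 : A)) = LinearMap.id := by
    refine TensorProduct.ext' fun m n => ?_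
    rw [Bialgebra.comul_one, Algebra.TensorProduct.one_def, pairAct_tmul, M.act_one, N.act_one]
    rfl
  rw [tens, h, LinearMap.range_id]

/-- For a Hopf algebra, the unit object is `K 1`, with `A` acting through the counit. -/
theorem unitIncl_act (a : A) (z : unitObj k A) :
    unitIncl k A ((unitObj k A).act a z) = counit (R := k) a • unitIncl k A z := by
  rw [unit_act, unitIncl_proj, ← counitS_unitIncl z, hopf_counitS, hopf_counitS]
  simp [Algebra.algebraMap_eq_smul_one, smul_smul, mul_comm]

end HopfCase

end RMod

/-! ### Weak group actions -/

open MonoidalCategory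

/-- A weak action of the group `G` on the `k`-algebra `A`: algebra automorphisms `φ g` which
compose up to the inner automorphisms given by invertible elements `c g h`, the latter
satisfying the cocycle condition. -/
structure WeakAction (k G A : Type u) [Field k] [Group G] [Ring A] [Algebra k A] where
  /-- the automorphisms -/
  φ : G → A ≃ₐ[k] A
  /-- the compositors -/
  c : G → G → Aˣ
  φ_φ : ∀ g h a, φ g (φ h a) = (c g h : A) * φ (g * h) a * ((c g h)⁻¹ : Aˣ)
  cocycle : ∀ g h l, φ g (c h l) * (c g (h * l) : A) = (c g h : A) * (c (g * h) l : A)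
  c_one_one : c 1 1 = 1

/-- A weak action of `G` on a (weak) Hopf algebra: `G` acts by automorphisms of (weak) Hopf
algebras and the compositors are grouplike, `Δ(c) = (c ⊗ c)Δ(1)`; for a Hopf algebra the latter
reads `Δ(c) = c ⊗ c`. -/
structure HopfAction (k G A : Type u) [Field k] [Group G] [Ring A] [Algebra k A]
    [Coalgebra k A] [WeakHopfAlgebra k A] extends WeakAction k G A where
  comul_φ : ∀ g a, comul (R := k) (φ g a) =
    TensorProduct.map (φ g).toLinearMap (φ g).toLinearMap (comul (R := k) a)
  counit_φ : ∀ g a, counit (R := k) (φ g a) = counit (R := k) a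
  antipode_φ : ∀ g a, WeakHopfAlgebra.antipode (k := k) (φ g a) =
    φ g (WeakHopfAlgebra.antipode (k := k) a)
  comul_c : ∀ g h, comul (R := k) (c g h : A) =
    ((c g h : A) ⊗ₜ[k] (c g h : A)) * comul (R := k) (1 : A)

/-- For a Hopf algebra, the compositors are grouplike in the usual sense. -/
theorem HopfAction.comul_c_hopf {k G A : Type u} [Field k] [Group G] [Ring A] [HopfAlgebra k A]
    (α : HopfAction k G A) (g h : G) :
    comul (R := k) (α.c g h : A) = (α.c g h : A) ⊗ₜ[k] (α.c g h : A) := by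
  rw [α.comul_c, Bialgebra.comul_one, mul_one]

/-- A weak action is strict if all its compositors are trivial. -/
def WeakAction.IsStrict {k G A : Type u} [Field k] [Group G] [Ring A] [Algebra k A]
    (α : WeakAction k G A) : Prop := ∀ g h, α.c g h = 1

/-! ### The induced action on the category of modules -/

namespace WeakAction

variable {k G A : Type u} [Field k] [Group G] [Ring A] [Algebra k A] (α : WeakAction k G A)

/-- The module `ᵍM`: the space `M` with the action `m.a := m.φ_{g⁻¹}(a)`. -/
abbrev twistObj (g : G) (M : RMod k A) : RMod k A where
  carrier := M
  act := M.act ∘ₗ (α.φ g⁻¹).toLinearMap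
  act_one m := by simp [M.act_one]
  act_mul a b m := by simp [M.act_mul]

/-- The functor `M ↦ ᵍM`, which is the identity on underlying linear maps. -/
abbrev twist (g : G) : RMod k A ⥤ RMod k A where
  obj := α.twistObj g
  map f := ⟨f.lin, fun a m => f.comm _ m⟩

/-- The compositor `α_{g,h} : ᵍ(ʰM) ≅ ᵍʰM`, `m ↦ m.c_{h⁻¹,g⁻¹}`. -/
noncomputable def compositor (g h : G) : α.twist h ⋙ α.twist g ≅ α.twist (g * h) :=
  NatIso.ofComponents
    (fun M => RMod.isoMk (M := (α.twist h ⋙ α.twist g).obj M) (N := (α.twist (g * h)).obj M)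
      ⟨M.act (α.c h⁻¹ g⁻¹ : A), fun a m => by
        change M.act _ (M.act (α.φ h⁻¹ (α.φ g⁻¹ a)) m) = M.act (α.φ (g * h)⁻¹ a) (M.act _ m)
        rw [← M.act_mul, ← M.act_mul, α.φ_φ, mul_inv_rev]
        simp⟩
      (M.act ((α.c h⁻¹ g⁻¹)⁻¹ : Aˣ))
      (by
        ext m
        change M.act _ (M.act _ m) = m
        rw [← M.act_mul, Units.mul_inv, M.act_one])
      (by
        ext m
        change M.act _ (M.act _ m) = m
        rw [← M.act_mul, Units.inv_mul, M.act_one]))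
    (fun {M N} f => RMod.hom_ext (by
      ext m
      exact (f.comm _ m).symm))

end WeakAction

namespace HopfAction

variable {k G A : Type u} [Field k] [Group G] [Ring A] [Algebra k A] [Coalgebra k A]
  [WeakHopfAlgebra k A] (α : HopfAction k G A)

theorem map_comul_one (g : G) : TensorProduct.map (α.φ g).toLinearMap (α.φ g).toLinearMap
    (comul (R := k) (1 : A)) = comul (R := k) (1 : A) := by
  rw [← α.comul_φ, map_one]

theorem counitS_φ (g : G) (a : A) : counitS k A (α.φ g a) = α.φ g (counitS k A a) := by
  rw [counitS_eq, counitS_eq]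
  conv_lhs => rw [← α.map_comul_one g]
  generalize comul (R := k) (1 : A) = X
  induction X with
  | zero => simp
  | add u v hu hv => simp only [map_add, hu, hv]
  | tmul a b => simp [← map_mul, α.counit_φ]

theorem pairAct_twist (g : G) (M N : RMod k A) (X : A ⊗[k] A) (w : M ⊗[k] N) :
    RMod.pairAct (α.twistObj g M) (α.twistObj g N) X w =
      RMod.pairAct M N (TensorProduct.map (α.φ g⁻¹).toLinearMap (α.φ g⁻¹).toLinearMap X) w := by
  induction X with
  | zero => simp
  | add u v hu hv => simp only [map_add, LinearMap.add_apply, hu, hv]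
  | tmul a b => rfl

/-- The identification of `ᵍM ⊗̄ ᵍN` and `ᵍ(M ⊗̄ N)`, two equal subspaces of `M ⊗ N`. -/
noncomputable def twistμ (g : G) (M N : RMod k A) :
    RMod.tensorObj (α.twistObj g M) (α.twistObj g N) ⟶ α.twistObj g (RMod.tensorObj M N) where
  lin := RMod.proj M N ∘ₗ RMod.incl (α.twistObj g M) (α.twistObj g N)
  comm a x := by
    simp only [LinearMap.comp_apply]
    rw [RMod.incl_act, pairAct_twist, ← α.comul_φ, RMod.act_proj]
    rfl

theorem twistμ_proj (g : G) (M N : RMod k A) (w : M ⊗[k] N) :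
    (α.twistμ g M N).lin (RMod.proj (α.twistObj g M) (α.twistObj g N) w) = RMod.proj M N w := by
  simp only [twistμ, LinearMap.comp_apply]
  rw [RMod.incl_proj, pairAct_twist, map_comul_one, RMod.proj_pairAct_comul_one]

/-- The isomorphism `ᵍM ⊗̄ ᵍN ≅ ᵍ(M ⊗̄ N)` which is the identity of the subspace of `M ⊗ N`. -/
noncomputable def twistμIso (g : G) (M N : RMod k A) :
    RMod.tensorObj (α.twistObj g M) (α.twistObj g N) ≅ α.twistObj g (RMod.tensorObj M N) :=
  RMod.isoMk (α.twistμ g M N)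
    (RMod.proj (α.twistObj g M) (α.twistObj g N) ∘ₗ RMod.incl M N)
    (by
      ext x
      obtain ⟨w, rfl⟩ := RMod.proj_surjective _ _ x
      simp only [LinearMap.comp_apply, LinearMap.id_apply]
      refine (congrArg _ (congrArg _ (α.twistμ_proj g M N w))).trans ?_
      rw [RMod.incl_proj]
      have := RMod.proj_pairAct_comul_one (α.twistObj g M) (α.twistObj g N) w
      rwa [pairAct_twist, map_comul_one] at this)
    (by
      ext x
      obtain ⟨w, rfl⟩ := RMod.proj_surjective M N x
      simp only [LinearMap.comp_apply, LinearMap.id_apply]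
      refine (α.twistμ_proj g M N _).trans ?_
      rw [RMod.proj_incl])

/-- The isomorphism `A_s ≅ ᵍA_s`, `z ↦ φ_{g⁻¹}(z)`. -/
noncomputable def twistεIso (g : G) : RMod.unitObj k A ≅ α.twistObj g (RMod.unitObj k A) :=
  RMod.isoMk
    ⟨RMod.unitProj k A ∘ₗ (α.φ g⁻¹).toLinearMap ∘ₗ RMod.unitIncl k A, fun a z => by
      change RMod.unitProj k A (α.φ g⁻¹ (counitS k A (RMod.unitIncl k A z * a))) =
        RMod.unitProj k A (counitS k A (α.φ g⁻¹ (RMod.unitIncl k A z)) * α.φ g⁻¹ a)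
      apply RMod.unitIncl_injective
      rw [RMod.unitIncl_proj, RMod.unitIncl_proj, counitS_counitS_mul, ← map_mul, counitS_φ,
        counitS_φ, counitS_counitS]⟩
    (RMod.unitProj k A ∘ₗ (α.φ g⁻¹).symm.toLinearMap ∘ₗ RMod.unitIncl k A)
    (by
      ext z
      change RMod.unitProj k A ((α.φ g⁻¹).symm (counitS k A (α.φ g⁻¹ (RMod.unitIncl k A z)))) = z
      rw [counitS_φ, AlgEquiv.symm_apply_apply, RMod.counitS_unitIncl, RMod.unitProj_incl])
    (by
      ext z
      change RMod.unitProj k A (α.φ g⁻¹ (counitS k A ((α.φ g⁻¹).symm (RMod.unitIncl k A z)))) = z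
      rw [← counitS_φ, AlgEquiv.apply_symm_apply, RMod.counitS_unitIncl, RMod.unitProj_incl])

theorem twistμIso_proj (g : G) (M N : RMod k A) (m : M) (n : N) :
    (α.twistμIso g M N).hom.lin (RMod.proj (α.twistObj g M) (α.twistObj g N) (m ⊗ₜ n)) =
      RMod.proj M N (m ⊗ₜ n) := α.twistμ_proj g M N _

theorem twistεIso_apply (g : G) (z : RMod.unitObj k A) :
    (α.twistεIso g).hom.lin z = RMod.unitProj k A (α.φ g⁻¹ (RMod.unitIncl k A z)) := rfl

theorem unitIncl_twistεIso (g : G) (z : RMod.unitObj k A) :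
    RMod.unitIncl k A ((α.twistεIso g).hom.lin z) = α.φ g⁻¹ (RMod.unitIncl k A z) := by
  rw [twistεIso_apply]
  change counitS k A _ = _
  rw [counitS_φ, RMod.counitS_unitIncl]

theorem conL_φ (g : G) (z : A) : conL (epsL k (α.φ g z)) (comul (R := k) (1 : A)) =
    α.φ g (conL (epsL k z) (comul (R := k) 1)) := by
  conv_lhs => rw [← α.map_comul_one g]
  generalize comul (R := k) (1 : A) = X
  induction X with
  | zero => simp
  | add u v hu hv => simp only [map_add, hu, hv]
  | tmul a b => simp [← map_mul, α.counit_φ]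

/-- `M ↦ ᵍM` is a tensor functor. -/
noncomputable def twistCore (g : G) : (α.twist g).CoreMonoidal where
  εIso := α.twistεIso g
  μIso M N := α.twistμIso g M N
  μIso_hom_natural_left {M N} f P := RMod.hom_ext (RMod.tens_ext fun m p => by
    change (α.twistμIso g N P).hom.lin ((RMod.tensorMap ((α.twist g).map f) (𝟙 _)).lin
        (RMod.proj (α.twistObj g M) (α.twistObj g P) (m ⊗ₜ p))) =
      (RMod.tensorMap f (𝟙 P)).lin ((α.twistμIso g M P).hom.lin
        (RMod.proj (α.twistObj g M) (α.twistObj g P) (m ⊗ₜ p)))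
    rw [twistμIso_proj, RMod.tensorMap_proj_tmul, RMod.tensorMap_proj_tmul]
    exact twistμIso_proj α g N P _ _)
  μIso_hom_natural_right {M N} P f := RMod.hom_ext (RMod.tens_ext fun p m => by
    change (α.twistμIso g P N).hom.lin ((RMod.tensorMap (𝟙 _) ((α.twist g).map f)).lin
        (RMod.proj (α.twistObj g P) (α.twistObj g M) (p ⊗ₜ m))) =
      (RMod.tensorMap (𝟙 P) f).lin ((α.twistμIso g P M).hom.lin
        (RMod.proj (α.twistObj g P) (α.twistObj g M) (p ⊗ₜ m)))
    rw [twistμIso_proj, RMod.tensorMap_proj_tmul, RMod.tensorMap_proj_tmul]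
    exact twistμIso_proj α g P N _ _)
  associativity M N P := RMod.hom_ext (RMod.tens_ext₃ fun m n p => by
    change (RMod.assocIso M N P).hom.lin ((α.twistμIso g (RMod.tensorObj M N) P).hom.lin
        ((RMod.tensorMap (α.twistμIso g M N).hom (𝟙 (α.twistObj g P))).lin
          (RMod.proj (RMod.tensorObj (α.twistObj g M) (α.twistObj g N)) (α.twistObj g P)
            (RMod.proj (α.twistObj g M) (α.twistObj g N) (m ⊗ₜ n) ⊗ₜ p)))) =
      (α.twistμIso g M (RMod.tensorObj N P)).hom.lin
        ((RMod.tensorMap (𝟙 (α.twistObj g M)) (α.twistμIso g N P).hom).lin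
          ((RMod.assocIso (α.twistObj g M) (α.twistObj g N) (α.twistObj g P)).hom.lin
            (RMod.proj (RMod.tensorObj (α.twistObj g M) (α.twistObj g N)) (α.twistObj g P)
              (RMod.proj (α.twistObj g M) (α.twistObj g N) (m ⊗ₜ n) ⊗ₜ p))))
    rw [RMod.assocIso_hom_gen, RMod.tensorMap_proj_tmul, RMod.tensorMap_proj_tmul,
      twistμIso_proj, twistμIso_proj]
    refine (RMod.assocIso_hom_gen M N P m n p).trans ?_
    refine Eq.trans ?_ (α.twistμIso_proj g M (RMod.tensorObj N P) m _).symm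
    exact congrArg (fun y => RMod.proj M (RMod.tensorObj N P) (m ⊗ₜ[k] y))
      (α.twistμIso_proj g N P n p).symm)
  left_unitality M := RMod.hom_ext (RMod.tens_ext fun (z : RMod.unitObj k A) m => by
    change (RMod.leftIso (α.twistObj g M)).hom.lin
        (RMod.proj (RMod.unitObj k A) (α.twistObj g M) (z ⊗ₜ m)) =
      (RMod.leftIso M).hom.lin ((α.twistμIso g (RMod.unitObj k A) M).hom.lin
        ((RMod.tensorMap (α.twistεIso g).hom (𝟙 (α.twistObj g M))).lin
          (RMod.proj (RMod.unitObj k A) (α.twistObj g M) (z ⊗ₜ m))))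
    rw [RMod.leftIso_hom_proj, RMod.tensorMap_proj_tmul, twistμIso_proj]
    refine Eq.trans ?_ (RMod.leftIso_hom_proj M _ _).symm
    rw [unitIncl_twistεIso, conL_φ]
    rfl)
  right_unitality M := RMod.hom_ext (RMod.tens_ext fun m (z : RMod.unitObj k A) => by
    change (RMod.rightIso (α.twistObj g M)).hom.lin
        (RMod.proj (α.twistObj g M) (RMod.unitObj k A) (m ⊗ₜ z)) =
      (RMod.rightIso M).hom.lin ((α.twistμIso g M (RMod.unitObj k A)).hom.lin
        ((RMod.tensorMap (𝟙 (α.twistObj g M)) (α.twistεIso g).hom).lin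
          (RMod.proj (α.twistObj g M) (RMod.unitObj k A) (m ⊗ₜ z))))
    rw [RMod.rightIso_hom_proj, RMod.tensorMap_proj_tmul, twistμIso_proj]
    refine Eq.trans ?_ (RMod.rightIso_hom_proj M _ _).symm
    rw [unitIncl_twistεIso]
    rfl)

noncomputable instance (g : G) : (α.twist g).Monoidal := (α.twistCore g).toMonoidal

end HopfAction

/-! ### Gradings -/

/-- A `G`-grading compatible with a weak action of `G` on a (weak) Hopf algebra `A`. A Hopf
algebra with a weak `G`-action and such a grading is a `G`-Hopf algebra. -/
structure Grading {k G A : Type u} [Field k] [Group G] [Ring A] [Algebra k A] [Coalgebra k A]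
    [WeakHopfAlgebra k A] (α : HopfAction k G A) where
  /-- the homogeneous components `A_g` -/
  comp : G → Submodule k A
  indep : iSupIndep comp
  iSup_eq_top : iSup comp = ⊤
  /-- `A` is the direct sum of the `A_g` as an algebra. -/
  mul_mem : ∀ g, ∀ a ∈ comp g, ∀ b ∈ comp g, a * b ∈ comp g
  mul_eq_zero : ∀ g h, g ≠ h → ∀ a ∈ comp g, ∀ b ∈ comp h, a * b = 0
  /-- `φ_g(A_h) ⊆ A_{ghg⁻¹}` -/
  φ_mem : ∀ g h, ∀ a ∈ comp h, α.φ g a ∈ comp (g * h * g⁻¹)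
  /-- `Δ(A_g) ⊆ ⨁_{pq = g} A_p ⊗ A_q` -/
  comul_mem : ∀ g, ∀ a ∈ comp g, comul (R := k) a ∈
    ⨆ (p : G) (q : G) (_ : p * q = g),
      LinearMap.range (TensorProduct.map (comp p).subtype (comp q).subtype)

/-- The objects of the homogeneous component `(A-mod)_h = A_h-mod` of the module category: the
action of `A` factors through the projection `A → A_h`. -/
def Grading.InDegree {k G A : Type u} [Field k] [Group G] [Ring A] [Algebra k A] [Coalgebra k A]
    [WeakHopfAlgebra k A] {α : HopfAction k G A} (𝒜 : Grading α) (h : G) (M : RMod k A) : Prop :=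
  ∀ g, g ≠ h → ∀ a ∈ 𝒜.comp g, ∀ m, M.act a m = 0

/-! ### Strictifications -/

/-- An equivalence `A-mod ≃ B-mod` of `k`-linear tensor categories with `G`-action. -/
structure EquivariantEquivalence {k G A B : Type u} [Field k] [Group G]
    [Ring A] [Algebra k A] [Coalgebra k A] [WeakHopfAlgebra k A]
    [Ring B] [Algebra k B] [Coalgebra k B] [WeakHopfAlgebra k B]
    (α : HopfAction k G A) (β : HopfAction k G B) where
  /-- the functor -/
  F : RMod k A ⥤ RMod k B
  isEquivalence : F.IsEquivalence
  [additive : F.Additive]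
  linear : F.Linear k
  /-- the (strong) tensor functor structure -/
  [monoidal : F.Monoidal]
  /-- `F` restricts to an equivalence of the categories of finite-dimensional modules. -/
  finiteDimensional_iff : ∀ M, FiniteDimensional k (F.obj M) ↔ FiniteDimensional k M
  /-- the equivariance isomorphisms `ψ_g : F(ᵍM) ≅ ᵍF(M)`, natural in `M` -/
  ψ : ∀ g, α.twist g ⋙ F ≅ F ⋙ β.twist g
  ψ_monoidal : ∀ g, NatTrans.IsMonoidal (ψ g).hom
  /-- the two morphisms `F(ᵍ(ʰM)) → ᵍʰF(M)` agree -/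
  ψ_coherence : ∀ g h M,
    (ψ g).hom.app ((α.twist h).obj M) ≫ (β.twist g).map ((ψ h).hom.app M) ≫
        (β.compositor g h).hom.app (F.obj M) =
      F.map ((α.compositor g h).hom.app M) ≫ (ψ (g * h)).hom.app M

/-- A strictification of a (weak) Hopf algebra with weak `G`-action: a weak Hopf algebra `B` with
strict `G`-action and an equivalence `A-mod ≃ B-mod` of tensor categories with `G`-action. -/
structure Strictification {k G A : Type u} [Field k] [Group G] [Ring A] [Algebra k A]
    [Coalgebra k A] [WeakHopfAlgebra k A] (α : HopfAction k G A) where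
  /-- the algebra -/
  B : Type u
  [ring : Ring B]
  [algebra : Algebra k B]
  [coalgebra : Coalgebra k B]
  [weakHopfAlgebra : WeakHopfAlgebra k B]
  /-- the action on `B` -/
  β : HopfAction k G B
  isStrict : β.IsStrict
  /-- the equivalence -/
  equiv : EquivariantEquivalence α β

attribute [instance] Strictification.ring Strictification.algebra Strictification.coalgebra
  Strictification.weakHopfAlgebra

/-- A strictification of a `G`-(weak) Hopf algebra: in addition `B` carries a compatible
`G`-grading, and the equivalence respects the gradings of the module categories. -/
structure GradedStrictification {k G A : Type u} [Field k] [Group G] [Ring A] [Algebra k A]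
    [Coalgebra k A] [WeakHopfAlgebra k A] (α : HopfAction k G A) (𝒜 : Grading α)
    extends Strictification α where
  /-- the grading of `B` -/
  grading : Grading β
  inDegree_iff : ∀ h M, grading.InDegree h (equiv.F.obj M) ↔ 𝒜.InDegree h M

/-- The strictification `S` is `K(G) ⊗ A ⊗ K[G]`, with the structure maps below, with `G` acting
by translation on `K(G)`, and the equivalence is `M ↦ M ⊗ K[G]`. -/
structure StandardForm {k G A : Type u} [Field k] [Group G] [Fintype G] [DecidableEq G]
    [Ring A] [Algebra k A] [Coalgebra k A] [WeakHopfAlgebra k A] {α : HopfAction k G A}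
    (S : Strictification α) where
  /-- the identification of the underlying vector space -/
  e : ((G → k) ⊗[k] (A ⊗[k] MonoidAlgebra k G)) ≃ₗ[k] S.B
  /-- the element `δ_g ⊗ a ⊗ h`, linear in `a` -/
  gen : G → G → A →ₗ[k] S.B
  gen_def : ∀ g h a,
    gen g h a = e (Pi.single g 1 ⊗ₜ[k] (a ⊗ₜ[k] MonoidAlgebra.single h (1 : k)))
  mul_gen : ∀ g a h g' a' h', gen g h a * gen g' h' a' =
    if g * h' = g' then gen g' (h * h') (a * α.φ h a' * (α.c h h' : A)) else 0
  one_eq : 1 = ∑ g, gen g 1 1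
  comul_gen : ∀ g a h, comul (R := k) (gen g h a) =
    TensorProduct.map (gen g h) (gen g h) (comul (R := k) a)
  counit_gen : ∀ g a h, counit (R := k) (gen g h a) = counit (R := k) a
  antipode_gen : ∀ g a h, WeakHopfAlgebra.antipode (k := k) (gen g h a) =
    gen (g * h⁻¹) h⁻¹ (((α.c h⁻¹ h)⁻¹ : Aˣ) * α.φ h⁻¹ (WeakHopfAlgebra.antipode (k := k) a))
  /-- both counital subalgebras are `K(G) ⊗ 1 ⊗ 1` -/
  range_counitT : LinearMap.range (counitT k S.B) =
    LinearMap.range (e.toLinearMap ∘ₗ (TensorProduct.mk k _ _).flip (1 ⊗ₜ[k] 1))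
  range_counitS : LinearMap.range (counitS k S.B) =
    LinearMap.range (e.toLinearMap ∘ₗ (TensorProduct.mk k _ _).flip (1 ⊗ₜ[k] 1))
  φ_gen : ∀ x g a h, S.β.φ x (gen g h a) = gen (x * g) h a
  /-- the identification of `M ⊗ K[G]` with `F(M)` -/
  θ : ∀ M : RMod k A, (M ⊗[k] MonoidAlgebra k G) ≃ₗ[k] S.equiv.F.obj M
  act_θ : ∀ (M : RMod k A) (m : M) (x g h : G) (a : A),
    (S.equiv.F.obj M).act (gen g h a) (θ M (m ⊗ₜ[k] MonoidAlgebra.single x (1 : k))) =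
      if x * h = g then
        θ M (M.act (α.φ x a * (α.c x h : A)) m ⊗ₜ[k] MonoidAlgebra.single g (1 : k))
      else 0
  map_θ : ∀ (M N : RMod k A) (f : M ⟶ N) (m : M) (y : MonoidAlgebra k G),
    (S.equiv.F.map f).lin (θ M (m ⊗ₜ[k] y)) = θ N (f.lin m ⊗ₜ[k] y)

end GHopf

/-!
# Strictification of weak actions on Hopf algebras

The algebra `K(G) ⊗ A ⊗ K[G]` is the algebra of `G × G` matrices over `A`, in which
`δ_g ⊗ a ⊗ h` is the matrix with the single entry `φ_x(a) c_{x,h}` at the place `(x, g)`, where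
`x = gh⁻¹` (`stdEquiv`, `stdGen_eq`). As the `φ_x` are automorphisms of Hopf algebras and the
compositors are grouplike, its coproduct, counit and antipode become entrywise operations on
matrices, independent of the action: the weak Hopf algebra is the tensor product of `A` with the
algebra of the pair groupoid on `G`. So it is a weak Hopf algebra for every Hopf algebra `A` and
every finite index set `n`. The functor `M ↦ M ⊗ K[G]` likewise becomes the Morita equivalence `row`
sending `M` to row vectors with entries in `M`. It is a tensor functor (`rowCore`), because
`Δ(1) = ∑ i, E_ii ⊗ E_ii` cuts the tensor product of two modules of row vectors down to the products
of vectors supported at the same place.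

Only the translation action involves the weak action on `A`. On matrices it is
`a E_ij ↦ c_{x,i}⁻¹ φ_x(a) c_{x,j} E_{xi,xj}`, and the cocycle condition makes it strict
(`matrixHom_matrixHom`). The equivariance isomorphism `ψ_g` moves the entry `m` at the place `x` to
the entry `m.c_{g⁻¹,x}` at the place `g⁻¹x`; it is monoidal since the compositors are grouplike
(`rowψ_isMonoidal`), and its coherence is the cocycle condition again (`rowψ_coherence`).

If `A` is graded, its components are ideals, so they are preserved by multiplication with
compositors, and matrices are graded by the degrees of their entries (`matrixGrading`).
-/

namespace GHopf

open CategoryTheory MonoidalCategory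

/-! ### The weak Hopf algebra of matrices over a Hopf algebra -/

section MatrixCoalgebra

variable {k A n : Type*} [Field k] [Ring A] [Algebra k A] [Coalgebra k A] [Fintype n]
  [DecidableEq n]

/-- Linear maps out of a matrix space agree if they agree on the `a E_ij`. -/
theorem matrix_lin_ext {V : Type*} [AddCommMonoid V] [Module k V] {f g : Matrix n n A →ₗ[k] V}
    (h : ∀ i j a, f (Matrix.single i j a) = g (Matrix.single i j a)) : f = g :=
  Matrix.ext_linearMap k fun i j => LinearMap.ext fun a => h i j a

/-- The entrywise coalgebra structure on matrices, `Δ(a E_ij) = a₁ E_ij ⊗ a₂ E_ij`; it is the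
tensor product of `A` with the coalgebra of the pair groupoid on `n`, whose arrows `E_ij` are
grouplike (and not the comatrix coalgebra). -/
noncomputable scoped instance : Coalgebra k (Matrix n n A) where
  comul := Matrix.liftLinear k fun i j => TensorProduct.map (Matrix.singleLinearMap k i j)
    (Matrix.singleLinearMap k i j) ∘ₗ comul
  counit := Matrix.liftLinear k fun _ _ => counit
  coassoc := by
    refine matrix_lin_ext fun i j a => ?_
    have h := congrArg (TensorProduct.map (Matrix.singleLinearMap k i j)
      (TensorProduct.map (Matrix.singleLinearMap k i j) (Matrix.singleLinearMap k i j)))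
      (coassoc_apply (R := k) a)
    simp only [LinearMap.comp_apply, Matrix.liftLinear_single, LinearEquiv.coe_coe]
    rw [← (Repr.arbitrary k a).eq] at h ⊢
    simp only [map_sum, LinearMap.lTensor_tmul, LinearMap.rTensor_tmul, TensorProduct.map_tmul,
      Matrix.singleLinearMap_apply, Matrix.liftLinear_single, LinearMap.comp_apply] at h ⊢
    rw [← h]
    exact Finset.sum_congr rfl fun x _ => (TensorProduct.map_map_assoc
      (Matrix.singleLinearMap k i j) (Matrix.singleLinearMap k i j)
      (Matrix.singleLinearMap k i j) (comul (R := k) _ ⊗ₜ[k] _)).symm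
  rTensor_counit_comp_comul := by
    refine matrix_lin_ext fun i j a => ?_
    have h := congrArg ((Matrix.singleLinearMap k i j).lTensor k)
      (rTensor_counit_comul (R := k) a)
    simp only [LinearMap.comp_apply, Matrix.liftLinear_single]
    rw [← (Repr.arbitrary k a).eq] at h ⊢
    simpa only [map_sum, LinearMap.rTensor_tmul, LinearMap.lTensor_tmul, TensorProduct.map_tmul,
      Matrix.singleLinearMap_apply, Matrix.liftLinear_single, TensorProduct.mk_apply,
      LinearMap.flip_apply] using h
  lTensor_counit_comp_comul := by
    refine matrix_lin_ext fun i j a => ?_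
    have h := congrArg ((Matrix.singleLinearMap k i j).rTensor k)
      (lTensor_counit_comul (R := k) a)
    simp only [LinearMap.comp_apply, Matrix.liftLinear_single]
    rw [← (Repr.arbitrary k a).eq] at h ⊢
    simpa only [map_sum, LinearMap.rTensor_tmul, LinearMap.lTensor_tmul, TensorProduct.map_tmul,
      Matrix.singleLinearMap_apply, Matrix.liftLinear_single, TensorProduct.mk_apply,
      LinearMap.flip_apply] using h

theorem comul_single (i j : n) (a : A) : comul (R := k) (Matrix.single i j a) =
    TensorProduct.map (Matrix.singleLinearMap k i j) (Matrix.singleLinearMap k i j)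
      (comul (R := k) a) :=
  Matrix.liftLinear_single ..

@[simp]
theorem counit_single (i j : n) (a : A) :
    counit (R := k) (Matrix.single i j a) = counit (R := k) a :=
  Matrix.liftLinear_single ..

theorem map_single_mul_map_single (i j l m : n) (X Y : A ⊗[k] A) :
    TensorProduct.map (Matrix.singleLinearMap k i j) (Matrix.singleLinearMap k i j) X *
      TensorProduct.map (Matrix.singleLinearMap k l m) (Matrix.singleLinearMap k l m) Y =
    if j = l then TensorProduct.map (Matrix.singleLinearMap k i m) (Matrix.singleLinearMap k i m)
      (X * Y) else 0 := by
  split_ifs with h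
  · subst h
    induction X with
    | zero => simp
    | add u v hu hv => simp only [map_add, add_mul, hu, hv]
    | tmul a b =>
      induction Y with
      | zero => simp
      | add u v hu hv => simp only [map_add, mul_add, hu, hv]
      | tmul c d => simp
  · induction X with
    | zero => simp
    | add u v hu hv => simp only [map_add, add_mul, hu, hv, add_zero]
    | tmul a b =>
      induction Y with
      | zero => simp
      | add u v hu hv => simp only [map_add, mul_add, hu, hv, add_zero]
      | tmul c d => simp [Matrix.single_mul_single_of_ne _ _ _ _ h]

theorem single_sum {ι : Type*} (s : Finset ι) (f : ι → A) (i j : n) :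
    Matrix.single i j (∑ x ∈ s, f x) = ∑ x ∈ s, Matrix.single i j (f x) :=
  map_sum (Matrix.singleAddMonoidHom i j) f s

theorem one_eq_sum_single : (1 : Matrix n n A) = ∑ i, Matrix.single i i 1 := by
  rw [← Matrix.diagonal_one, Matrix.sum_single_eq_diagonal]

end MatrixCoalgebra

section MatrixWeakHopf

variable {k A n : Type*} [Field k] [Ring A] [HopfAlgebra k A] [Fintype n] [DecidableEq n]

theorem comul_matrix_one : comul (R := k) (1 : Matrix n n A) =
    ∑ i, Matrix.single i i 1 ⊗ₜ[k] Matrix.single i i 1 := by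
  simp [one_eq_sum_single, comul_single, Algebra.TensorProduct.one_def]

theorem single_mul_single (i j l m : n) (a b : A) :
    Matrix.single i j a * Matrix.single l m b = if j = l then Matrix.single i m (a * b) else 0 := by
  split_ifs with h
  · subst h; simp
  · simp [Matrix.single_mul_single_of_ne _ _ _ _ h]

theorem counitT_single (i j : n) (a : A) : counitT k (Matrix n n A) (Matrix.single i j a) =
    counit (R := k) a • Matrix.single i i 1 := by
  simp [counitT, comul_matrix_one, Finset.sum_mul, single_mul_single, apply_ite, ite_smul]

theorem counitS_single (i j : n) (a : A) : counitS k (Matrix n n A) (Matrix.single i j a) =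
    counit (R := k) a • Matrix.single j j 1 := by
  simp [counitS, comul_matrix_one, Finset.mul_sum, single_mul_single, apply_ite]

theorem counit_mul_single (X : Matrix n n A) (i j : n) (a : A) :
    counit (R := k) (X * Matrix.single i j a) =
      (∑ l, counit (R := k) (X l i)) * counit (R := k) a := by
  induction X using Matrix.induction_on' with
  | h_zero => simp
  | h_add p q hp hq =>
    simp only [add_mul, map_add, hp, hq, Matrix.add_apply, Finset.sum_add_distrib]
  | h_std_basis l m b =>
    rw [single_mul_single]
    split_ifs with h <;> simp [Matrix.single_apply, apply_ite, h]

theorem counit_single_mul (X : Matrix n n A) (i j : n) (a : A) :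
    counit (R := k) (Matrix.single i j a * X) =
      counit (R := k) a * ∑ l, counit (R := k) (X j l) := by
  induction X using Matrix.induction_on' with
  | h_zero => simp
  | h_add p q hp hq =>
    simp only [mul_add, map_add, hp, hq, Matrix.add_apply, Finset.sum_add_distrib]
  | h_std_basis l m b =>
    rw [single_mul_single]
    split_ifs with h
    · simp [Matrix.single_apply, apply_ite, h]
    · simp [Ne.symm h]

theorem counit_mul_single_mul (X Z : Matrix n n A) (i j : n) (a : A) :
    counit (R := k) (X * Matrix.single i j a * Z) =
      (∑ l, counit (R := k) (X l i)) * counit (R := k) a * ∑ l, counit (R := k) (Z j l) := by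
  induction X using Matrix.induction_on' with
  | h_zero => simp
  | h_add p q hp hq =>
    simp only [add_mul, map_add, hp, hq, Matrix.add_apply, Finset.sum_add_distrib]
  | h_std_basis l m b =>
    rw [single_mul_single]
    split_ifs with h <;> simp [Matrix.single_apply, apply_ite, h, counit_single_mul]

/-- The antipode `a E_ij ↦ S(a) E_ji`. -/
noncomputable def matrixAntipode : Matrix n n A →ₗ[k] Matrix n n A where
  toFun X := X.transpose.map (HopfAlgebra.antipode k)
  map_add' X Y := by ext; simp
  map_smul' c X := by ext; simp

@[simp]
theorem matrixAntipode_single (i j : n) (a : A) :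
    matrixAntipode (k := k) (Matrix.single i j a) =
      Matrix.single j i (HopfAlgebra.antipode k a) := by
  simp [matrixAntipode, Matrix.transpose_single, Matrix.map_single]

theorem mul_matrixAntipode_single (i j : n) (a : A) :
    LinearMap.mul' k (Matrix n n A)
      (matrixAntipode.lTensor (Matrix n n A) (comul (R := k) (Matrix.single i j a))) =
    counit (R := k) a • Matrix.single i i 1 := by
  rw [Matrix.smul_single,
    ← HopfAlgebra.sum_mul_antipode_eq_smul (Repr.arbitrary k a), comul_single]
  conv_lhs => rw [← (Repr.arbitrary k a).eq]
  simp [single_sum]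

/-- Matrices over a Hopf algebra form a weak Hopf algebra: the tensor product of `A` with the
groupoid algebra of the pair groupoid. -/
noncomputable scoped instance : WeakHopfAlgebra k (Matrix n n A) where
  comul_mul X Y := by
    induction X using Matrix.induction_on' with
    | h_zero => simp
    | h_add p q hp hq => simp only [add_mul, map_add, hp, hq]
    | h_std_basis i j a =>
      induction Y using Matrix.induction_on' with
      | h_zero => simp
      | h_add p q hp hq => simp only [mul_add, map_add, hp, hq]
      | h_std_basis l m b =>
        rw [comul_single, comul_single, map_single_mul_map_single, single_mul_single]
        split_ifs
        · rw [comul_single, Bialgebra.comul_mul]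
        · simp
  comul_one_left := by
    simp only [comul_matrix_one, map_sum, LinearMap.lTensor_tmul, comul_single,
      Bialgebra.comul_one, Algebra.TensorProduct.one_def, TensorProduct.sum_tmul,
      TensorProduct.tmul_sum, Finset.sum_mul_sum, TensorProduct.map_tmul,
      TensorProduct.assoc_tmul, Algebra.TensorProduct.tmul_mul_tmul, mul_one, one_mul,
      Matrix.singleLinearMap_apply, single_mul_single]
    simp [TensorProduct.tmul_ite, TensorProduct.ite_tmul]
  comul_one_right := by
    simp only [comul_matrix_one, map_sum, LinearMap.lTensor_tmul, comul_single,
      Bialgebra.comul_one, Algebra.TensorProduct.one_def, TensorProduct.sum_tmul,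
      TensorProduct.tmul_sum, Finset.sum_mul_sum, TensorProduct.map_tmul,
      TensorProduct.assoc_tmul, Algebra.TensorProduct.tmul_mul_tmul, mul_one, one_mul,
      Matrix.singleLinearMap_apply, single_mul_single]
    simp [TensorProduct.tmul_ite, TensorProduct.ite_tmul]
  counit_mul_left X Y Z := by
    induction Y using Matrix.induction_on' with
    | h_zero => simp
    | h_add p q hp hq => simp only [mul_add, add_mul, map_add, hp, hq]
    | h_std_basis i j a =>
      rw [counit_mul_single_mul, comul_single]
      conv_lhs => rw [← repr_counit_left (Repr.arbitrary k a)]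
      conv_rhs => rw [← (Repr.arbitrary k a).eq]
      simp only [map_sum, map_smul, smul_eq_mul,
        TensorProduct.map_tmul, Matrix.singleLinearMap_apply, LinearMap.comp_apply,
        LinearMap.mulLeft_apply, LinearMap.mulRight_apply, LinearMap.mul'_apply,
        counit_mul_single, counit_single_mul]
      generalize (∑ l, counit (R := k) (X l i)) = u
      generalize (∑ l, counit (R := k) (Z j l)) = v
      simp only [Finset.mul_sum, Finset.sum_mul]
      exact Finset.sum_congr rfl fun _ _ => by ring
  counit_mul_right X Y Z := by
    induction Y using Matrix.induction_on' with
    | h_zero => simp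
    | h_add p q hp hq => simp only [mul_add, add_mul, map_add, hp, hq]
    | h_std_basis i j a =>
      rw [counit_mul_single_mul, comul_single]
      conv_lhs => rw [← repr_counit_left (Repr.arbitrary k a)]
      conv_rhs => rw [← (Repr.arbitrary k a).eq]
      simp only [map_sum, map_smul, smul_eq_mul,
        TensorProduct.map_tmul, Matrix.singleLinearMap_apply, LinearMap.comp_apply,
        LinearMap.mulLeft_apply, LinearMap.mulRight_apply, LinearMap.mul'_apply,
        counit_mul_single, counit_single_mul]
      generalize (∑ l, counit (R := k) (X l i)) = u
      generalize (∑ l, counit (R := k) (Z j l)) = v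
      simp only [Finset.mul_sum, Finset.sum_mul]
      exact Finset.sum_congr rfl fun _ _ => by ring
  antipode := matrixAntipode
  mul_antipode X := by
    induction X using Matrix.induction_on' with
    | h_zero => simp
    | h_add p q hp hq => simp only [map_add, hp, hq]
    | h_std_basis i j a =>
      rw [counitT_single, mul_matrixAntipode_single]
  antipode_mul X := by
    induction X using Matrix.induction_on' with
    | h_zero => simp
    | h_add p q hp hq => simp only [map_add, hp, hq]
    | h_std_basis i j a =>
      rw [counitS_single, Matrix.smul_single,
        ← HopfAlgebra.sum_antipode_mul_eq_smul (Repr.arbitrary k a), comul_single]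
      conv_lhs => rw [← (Repr.arbitrary k a).eq]
      simp [single_sum]
  antipode_mul_antipode X := by
    induction X using Matrix.induction_on' with
    | h_zero => simp only [map_zero]
    | h_add p q hp hq => simp only [map_add, hp, hq]
    | h_std_basis i j a =>
      rw [comul_single, matrixAntipode_single]
      conv_rhs => rw [← repr_counit_right (Repr.arbitrary k a)]
      conv_lhs => rw [← (Repr.arbitrary k a).eq]
      simp only [map_sum, TensorProduct.map_tmul, LinearMap.comp_apply, LinearMap.mul'_apply,
        Matrix.singleLinearMap_apply, matrixAntipode_single, mul_matrixAntipode_single,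
        single_sum, map_smul]
      simp

end MatrixWeakHopf

/-! ### The Morita equivalence given by row vectors -/

namespace RMod

section RowVectors

variable {k A n : Type u} [Field k] [Ring A] [Algebra k A] [Fintype n] [DecidableEq n]

variable (n) in
/-- The right module of row vectors with entries in `M` over the algebra of matrices, with
`(v.X)_j = ∑ i, v_i.X_ij`. -/
noncomputable def rowObj (M : RMod k A) : RMod k (Matrix n n A) where
  carrier := n → M
  act := LinearMap.mk₂ k (fun X v j => ∑ i, M.act (X i j) (v i))
    (fun _ _ _ => by ext; simp [Finset.sum_add_distrib])
    (fun _ _ _ => by ext; simp [Finset.smul_sum])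
    (fun _ _ _ => by ext; simp [Finset.sum_add_distrib])
    (fun _ _ _ => by ext; simp [Finset.smul_sum])
  act_one v := by
    ext j
    simp only [LinearMap.mk₂_apply]
    rw [Finset.sum_eq_single j (fun i _ h => by simp [Matrix.one_apply_ne h]) (by simp)]
    rw [Matrix.one_apply_eq, M.act_one]
  act_mul X Y v := by
    ext j
    simp only [LinearMap.mk₂_apply, Matrix.mul_apply, map_sum, LinearMap.sum_apply, M.act_mul]
    exact Finset.sum_comm

/-- The row vector with entry `m` at place `i` and zeros elsewhere. -/
noncomputable def rowSingle (M : RMod k A) (i : n) : M →ₗ[k] rowObj n M :=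
  LinearMap.single k (fun _ : n => M) i

/-- The `i`-th entry of a row vector. -/
noncomputable def rowEval (M : RMod k A) (i : n) : rowObj n M →ₗ[k] M :=
  LinearMap.proj (φ := fun _ : n => M) i

theorem rowEval_rowSingle (M : RMod k A) (i j : n) (m : M) :
    rowEval M i (rowSingle M j m) = if j = i then m else 0 := by
  simp only [eq_comm (a := j)]
  exact Pi.single_apply j m i

@[simp]
theorem rowEval_rowSingle_self (M : RMod k A) (i : n) (m : M) :
    rowEval M i (rowSingle M i m) = m := by
  simp [rowEval_rowSingle]

theorem row_ext {M : RMod k A} {V : Type*} [AddCommMonoid V] [Module k V]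
    {f g : rowObj n M →ₗ[k] V} (h : ∀ i m, f (rowSingle M i m) = g (rowSingle M i m)) : f = g :=
  LinearMap.pi_ext (φ := fun _ : n => M) h

theorem row_eq_sum {M : RMod k A} (v : rowObj n M) : v = ∑ i, rowSingle M i (rowEval M i v) :=
  (LinearMap.sum_single_apply (φ := fun _ : n => M) v).symm

theorem row_eval_ext {M : RMod k A} {v w : rowObj n M} (h : ∀ i, rowEval M i v = rowEval M i w) :
    v = w := by
  rw [row_eq_sum v, row_eq_sum w]
  simp only [h]

theorem rowEval_act (M : RMod k A) (X : Matrix n n A) (v : rowObj n M) (j : n) :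
    rowEval M j ((rowObj n M).act X v) = ∑ i, M.act (X i j) (rowEval M i v) := rfl

theorem act_rowSingle (M : RMod k A) (i j l : n) (a : A) (m : M) :
    (rowObj n M).act (Matrix.single i j a) (rowSingle M l m) =
      if l = i then rowSingle M j (M.act a m) else 0 := by
  refine row_eval_ext fun j' => ?_
  rw [rowEval_act, Finset.sum_eq_single l
    (fun i' _ h => by rw [rowEval_rowSingle, if_neg h.symm, map_zero]) (by simp)]
  rw [rowEval_rowSingle_self, Matrix.single_apply]
  by_cases h : l = i
  · subst h
    by_cases hj : j = j' <;> simp [rowEval_rowSingle, hj]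
  · simp [h, Ne.symm h]

/-- The map into row vectors with given entries. -/
noncomputable def rowPi {M : RMod k A} {V : Type*} [AddCommMonoid V] [Module k V]
    (f : n → V →ₗ[k] M) : V →ₗ[k] rowObj n M := LinearMap.pi (φ := fun _ : n => M) f

@[simp]
theorem rowEval_rowPi {M : RMod k A} {V : Type*} [AddCommMonoid V] [Module k V]
    (f : n → V →ₗ[k] M) (i : n) (x : V) : rowEval M i (rowPi f x) = f i x := rfl

variable (n) in
/-- A morphism applied to the entries of row vectors. -/
noncomputable def rowMap {M N : RMod k A} (f : M ⟶ N) : rowObj n M ⟶ rowObj n N where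
  lin := rowPi fun i => f.lin ∘ₗ rowEval M i
  comm X v := row_eval_ext fun j => by simp [rowEval_act, f.comm]

@[simp]
theorem rowMap_rowSingle {M N : RMod k A} (f : M ⟶ N) (i : n) (m : M) :
    (rowMap n f).lin (rowSingle M i m) = rowSingle N i (f.lin m) :=
  row_eval_ext fun j => by simp [rowMap, rowEval_rowSingle, apply_ite f.lin]

variable (k A n) in
/-- The functor sending a module to the row vectors with entries in it. -/
noncomputable abbrev row : RMod k A ⥤ RMod k (Matrix n n A) where
  obj := rowObj n
  map := rowMap n

instance : (row k A n).Additive where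
  map_add {_ _ _ _} := rfl

instance : (row k A n).Linear k where
  map_smul _ _ := rfl

instance [Nonempty n] : (row k A n).Faithful where
  map_injective {M N} f g h := by
    obtain ⟨i⟩ := ‹Nonempty n›
    refine hom_ext (LinearMap.ext fun m => ?_)
    have := congrArg (fun F : rowObj n M ⟶ rowObj n N => rowEval N i (F.lin (rowSingle M i m))) h
    simpa using this

/-- A morphism of row vector modules commutes with the matrix units `E_ij`, so it is determined by
its corner at any single place `i`. -/
theorem row_hom_apply {M N : RMod k A} (f : rowObj n M ⟶ rowObj n N) (i j : n) (a : A) (m : M) :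
    f.lin (rowSingle M j (M.act a m)) =
      rowSingle N j (N.act a (rowEval N i (f.lin (rowSingle M i m)))) := by
  have h := f.comm (Matrix.single i j a) (rowSingle M i m)
  rw [act_rowSingle, if_pos rfl, row_eq_sum (M := N) (f.lin (rowSingle M i m)), map_sum] at h
  simpa only [act_rowSingle, Finset.sum_ite_eq', Finset.mem_univ, if_true] using h

instance [Nonempty n] : (row k A n).Full where
  map_surjective {M N} (f : rowObj n M ⟶ rowObj n N) := by
    obtain ⟨i⟩ := ‹Nonempty n›
    refine ⟨⟨rowEval N i ∘ₗ f.lin ∘ₗ rowSingle M i, fun a m => ?_⟩, hom_ext (row_ext fun j m => ?_)⟩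
    · change rowEval N i (f.lin (rowSingle M i (M.act a m))) = _
      rw [row_hom_apply f i, rowEval_rowSingle_self]
      rfl
    · rw [rowMap_rowSingle]
      have h := row_hom_apply f i j 1 m
      rw [M.act_one, N.act_one] at h
      exact h.symm

/-- The corner `N.E_ii` of a module over matrices. -/
noncomputable def corner (i : n) (N : RMod k (Matrix n n A)) : RMod k A where
  carrier := LinearMap.range (N.act (Matrix.single i i (1 : A)))
  act := LinearMap.mk₂ k
    (fun a x => ⟨N.act (Matrix.single i i a) x.1, N.act (Matrix.single i i a) x.1, by
      rw [← N.act_mul]; simp⟩)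
    (fun _ _ _ => Subtype.ext (by simp [Matrix.single_add]))
    (fun _ _ _ => Subtype.ext (by simp [← Matrix.smul_single]))
    (fun _ _ _ => Subtype.ext (by simp)) (fun _ _ _ => Subtype.ext (by simp))
  act_one := by
    rintro ⟨_, x, rfl⟩
    exact Subtype.ext (by simp [← N.act_mul])
  act_mul a b x := Subtype.ext (by simp [← N.act_mul])

/-- The inclusion of the corner. -/
noncomputable def cornerIncl (i : n) (N : RMod k (Matrix n n A)) : corner i N →ₗ[k] N :=
  (LinearMap.range (N.act (Matrix.single i i (1 : A)))).subtype

theorem cornerIncl_injective (i : n) (N : RMod k (Matrix n n A)) :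
    Function.Injective (cornerIncl i N) := Subtype.coe_injective

theorem cornerIncl_act (i : n) (N : RMod k (Matrix n n A)) (a : A) (x : corner i N) :
    cornerIncl i N ((corner i N).act a x) = N.act (Matrix.single i i a) (cornerIncl i N x) := rfl

/-- The map `w ↦ w.E_ji` from a module to its corner at `i`. -/
noncomputable def toCorner (i j : n) (N : RMod k (Matrix n n A)) : N →ₗ[k] corner i N :=
  (N.act (Matrix.single j i 1)).codRestrict _ fun w => ⟨N.act (Matrix.single j i 1) w, by
    rw [← N.act_mul]; simp⟩

theorem cornerIncl_toCorner (i j : n) (N : RMod k (Matrix n n A)) (w : N) :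
    cornerIncl i N (toCorner i j N w) = N.act (Matrix.single j i 1) w := rfl

/-- The map sending the row vector `v` over the corner of `N` at `i` to `∑ j, v_j.E_ij`. -/
noncomputable def rowCornerLin (i : n) (N : RMod k (Matrix n n A)) :
    rowObj n (corner i N) →ₗ[k] N :=
  ∑ j, N.act (Matrix.single i j 1) ∘ₗ cornerIncl i N ∘ₗ rowEval (corner i N) j

theorem rowCornerLin_rowSingle (i j : n) (N : RMod k (Matrix n n A)) (x : corner i N) :
    rowCornerLin i N (rowSingle _ j x) = N.act (Matrix.single i j 1) (cornerIncl i N x) := by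
  simp [rowCornerLin, rowEval_rowSingle, apply_ite]

/-- A module over matrices is the module of row vectors over its corner. -/
noncomputable def rowCornerIso (i : n) (N : RMod k (Matrix n n A)) : rowObj n (corner i N) ≅ N :=
  isoMk
    ⟨rowCornerLin i N, fun X v => by
      induction X using Matrix.induction_on' with
      | h_zero => simp
      | h_add p q hp hq => simp only [map_add, LinearMap.add_apply, hp, hq]
      | h_std_basis j l a =>
        suffices h : rowCornerLin i N ∘ₗ (rowObj n (corner i N)).act (Matrix.single j l a) =
            N.act (Matrix.single j l a) ∘ₗ rowCornerLin i N from LinearMap.congr_fun h v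
        refine row_ext fun j' x => ?_
        simp only [LinearMap.comp_apply]
        rw [act_rowSingle, rowCornerLin_rowSingle, ← N.act_mul, single_mul_single]
        split_ifs
        · rw [rowCornerLin_rowSingle, cornerIncl_act, ← N.act_mul]
          simp
        · simp⟩
    (rowPi fun j => toCorner i j N)
    (row_ext fun j x => row_eval_ext fun l => by
      refine cornerIncl_injective i N ?_
      change cornerIncl i N (toCorner i l N (rowCornerLin i N (rowSingle _ j x))) =
        cornerIncl i N (rowEval _ l (rowSingle _ j x))
      rw [cornerIncl_toCorner, rowCornerLin_rowSingle, ← N.act_mul, single_mul_single,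
        rowEval_rowSingle]
      split_ifs
      · rw [mul_one, ← cornerIncl_act, act_one]
      · simp)
    (by
      ext w
      simp only [rowCornerLin, LinearMap.comp_apply, LinearMap.sum_apply, rowEval_rowPi,
        cornerIncl_toCorner, ← N.act_mul, single_mul_single, if_true, mul_one]
      rw [← LinearMap.sum_apply, ← map_sum, ← one_eq_sum_single, N.act_one]
      rfl)

theorem row_isEquivalence [Nonempty n] : (row k A n).IsEquivalence where
  essSurj := ⟨fun N => by
    obtain ⟨i⟩ := ‹Nonempty n›
    exact ⟨corner i N, ⟨rowCornerIso i N⟩⟩⟩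

theorem finiteDimensional_rowObj_iff [Nonempty n] (M : RMod k A) :
    FiniteDimensional k (rowObj n M) ↔ FiniteDimensional k M := by
  obtain ⟨i⟩ := ‹Nonempty n›
  refine ⟨fun h => ?_, fun h => ?_⟩
  · exact Module.Finite.of_surjective (rowEval M i) fun m => ⟨_, rowEval_rowSingle_self M i m⟩
  · exact inferInstanceAs (FiniteDimensional k (n → M))

end RowVectors

end RMod

/-! ### The tensor structure of the row vector functor -/

namespace RMod

section RowTensor

variable {k A n : Type u} [Field k] [Ring A] [HopfAlgebra k A] [Fintype n] [DecidableEq n]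

theorem pairAct_one (M N : RMod k A) (w : M ⊗[k] N) :
    pairAct M N (comul (R := k) (1 : A)) w = w :=
  pairAct_of_mem_tens M N (by rw [tens_eq_top]; trivial)

theorem pairAct_rowSingle (M N : RMod k A) (i j l l' : n) (a : A) (m : M) (m' : N) :
    pairAct (rowObj n M) (rowObj n N) (comul (R := k) (Matrix.single i j a))
      (rowSingle M l m ⊗ₜ rowSingle N l' m') =
    if l = i ∧ l' = i then TensorProduct.map (rowSingle M j) (rowSingle N j)
      (pairAct M N (comul (R := k) a) (m ⊗ₜ m')) else 0 := by
  rw [comul_single]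
  generalize comul (R := k) a = X
  induction X with
  | zero => simp
  | add u v hu hv => simp only [map_add, LinearMap.add_apply, hu, hv]; split_ifs <;> simp
  | tmul b c =>
    simp only [TensorProduct.map_tmul, Matrix.singleLinearMap_apply, pairAct_tmul, act_rowSingle]
    by_cases h : l = i <;> by_cases h' : l' = i <;> simp [h, h']

theorem pairAct_one_rowSingle (M N : RMod k A) (l l' : n) (m : M) (m' : N) :
    pairAct (rowObj n M) (rowObj n N) (comul (R := k) (1 : Matrix n n A))
      (rowSingle M l m ⊗ₜ rowSingle N l' m') =
    if l = l' then rowSingle M l m ⊗ₜ rowSingle N l' m' else 0 := by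
  rw [one_eq_sum_single, map_sum, map_sum, LinearMap.sum_apply]
  simp only [pairAct_rowSingle, pairAct_one, TensorProduct.map_tmul]
  split_ifs with h
  · subst h; simp
  · exact Finset.sum_eq_zero fun i _ => if_neg fun hi => h (hi.1.trans hi.2.symm)

theorem proj_rowSingle_of_ne (M N : RMod k A) {l l' : n} (h : l ≠ l') (m : M) (m' : N) :
    proj (rowObj n M) (rowObj n N) (rowSingle M l m ⊗ₜ rowSingle N l' m') = 0 := by
  apply incl_injective
  rw [incl_proj, pairAct_one_rowSingle, if_neg h, map_zero]

theorem row_tmul_ext {M N : RMod k A} {V : Type*} [AddCommMonoid V] [Module k V]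
    {f g : rowObj n M ⊗[k] rowObj n N →ₗ[k] V}
    (h : ∀ i j m m', f (rowSingle M i m ⊗ₜ rowSingle N j m') =
      g (rowSingle M i m ⊗ₜ rowSingle N j m')) : f = g :=
  TensorProduct.ext <| row_ext fun i m => row_ext fun j m' => h i j m m'

/-- The tensor product of two row vector modules is spanned by the tensors of row vectors
supported at the same place. -/
theorem row_tens_ext {M N : RMod k A} {V : Type*} [AddCommMonoid V] [Module k V]
    {f g : tensorObj (rowObj n M) (rowObj n N) →ₗ[k] V}
    (h : ∀ i m m', f (proj _ _ (rowSingle M i m ⊗ₜ rowSingle N i m')) =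
      g (proj _ _ (rowSingle M i m ⊗ₜ rowSingle N i m'))) : f = g := by
  have key : f ∘ₗ proj _ _ = g ∘ₗ proj _ _ := row_tmul_ext fun i j m m' => by
    simp only [LinearMap.comp_apply]
    by_cases hij : i = j
    · subst hij; exact h i m m'
    · rw [proj_rowSingle_of_ne M N hij, map_zero, map_zero]
  ext x
  obtain ⟨w, rfl⟩ := proj_surjective _ _ x
  exact LinearMap.congr_fun key w

/-- The entrywise product `v ⊗ w ↦ (v_i ⊗ w_i)_i`. -/
noncomputable def rowPair (M N : RMod k A) :
    rowObj n M ⊗[k] rowObj n N →ₗ[k] rowObj n (tensorObj M N) :=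
  rowPi fun i => proj M N ∘ₗ TensorProduct.map (rowEval M i) (rowEval N i)

theorem rowPair_rowSingle (M N : RMod k A) (i j : n) (m : M) (m' : N) :
    rowPair M N (rowSingle M i m ⊗ₜ rowSingle N j m') =
      if i = j then rowSingle _ i (proj M N (m ⊗ₜ m')) else 0 := by
  refine row_eval_ext fun l => ?_
  simp only [rowPair, rowEval_rowPi, LinearMap.comp_apply, TensorProduct.map_tmul,
    rowEval_rowSingle]
  by_cases h : i = j
  · subst h; by_cases h' : i = l <;> simp [rowEval_rowSingle, h']
  · by_cases h' : i = l
    · subst h'; simp [h, Ne.symm h]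
    · simp [h, h']

/-- The tensorator of the row vector functor. -/
noncomputable def rowμ (M N : RMod k A) :
    tensorObj (rowObj n M) (rowObj n N) ⟶ rowObj n (tensorObj M N) where
  lin := rowPair M N ∘ₗ incl _ _
  comm X x := by
    have h : rowPair M N ∘ₗ pairAct (rowObj n M) (rowObj n N) (comul (R := k) X) =
        (rowObj n (tensorObj M N)).act X ∘ₗ rowPair M N := by
      refine row_tmul_ext fun l l' m m' => ?_
      simp only [LinearMap.comp_apply]
      induction X using Matrix.induction_on' with
      | h_zero => simp
      | h_add p q hp hq => simp only [map_add, LinearMap.add_apply, hp, hq]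
      | h_std_basis i j a =>
        rw [pairAct_rowSingle, rowPair_rowSingle]
        by_cases h : l = l'
        · subst h
          rw [if_pos rfl, act_rowSingle]
          by_cases h' : l = i
          · rw [if_pos h', if_pos ⟨h', h'⟩, act_proj]
            generalize pairAct M N (comul (R := k) a) (m ⊗ₜ m') = w
            induction w with
            | zero => simp
            | add u v hu hv => simp only [map_add, hu, hv]
            | tmul u v => rw [TensorProduct.map_tmul, rowPair_rowSingle, if_pos rfl]
          · rw [if_neg h', if_neg (fun H => h' H.1), map_zero]
        · rw [if_neg h, map_zero, if_neg fun H => h (H.1.trans H.2.symm), map_zero]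
    simp only [LinearMap.comp_apply]
    rw [incl_act]
    exact LinearMap.congr_fun h _

theorem rowμ_rowSingle (M N : RMod k A) (i : n) (m : M) (m' : N) :
    (rowμ M N).lin (proj _ _ (rowSingle M i m ⊗ₜ rowSingle N i m')) =
      rowSingle _ i (proj M N (m ⊗ₜ m')) := by
  simp only [rowμ, LinearMap.comp_apply]
  rw [incl_proj, pairAct_one_rowSingle, if_pos rfl, rowPair_rowSingle, if_pos rfl]

/-- The inverse `(m_i ⊗ m'_i)_i ↦ ∑ i, m_i e_i ⊗ m'_i e_i` of the tensorator. -/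
noncomputable def rowμInv (M N : RMod k A) :
    rowObj n (tensorObj M N) →ₗ[k] tensorObj (rowObj n M) (rowObj n N) :=
  ∑ i, proj _ _ ∘ₗ TensorProduct.map (rowSingle M i) (rowSingle N i) ∘ₗ incl M N ∘ₗ rowEval _ i

theorem rowμInv_rowSingle (M N : RMod k A) (i : n) (m : M) (m' : N) :
    rowμInv M N (rowSingle _ i (proj M N (m ⊗ₜ m'))) =
      proj _ _ (rowSingle M i m ⊗ₜ rowSingle N i m') := by
  rw [rowμInv, LinearMap.sum_apply, Finset.sum_eq_single i]
  · simp only [LinearMap.comp_apply, rowEval_rowSingle_self]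
    rw [incl_proj, pairAct_one, TensorProduct.map_tmul]
  · intro j _ h
    simp [rowEval_rowSingle, h.symm]
  · simp

/-- The isomorphism `Mⁿ ⊗̄ Nⁿ ≅ (M ⊗ N)ⁿ`. -/
noncomputable def rowμIso (M N : RMod k A) :
    tensorObj (rowObj n M) (rowObj n N) ≅ rowObj n (tensorObj M N) :=
  isoMk (rowμ M N) (rowμInv M N)
    (row_tens_ext fun i m m' => by
      simp only [LinearMap.comp_apply, LinearMap.id_apply]
      rw [rowμ_rowSingle, rowμInv_rowSingle])
    (row_ext fun i x => by
      obtain ⟨w, rfl⟩ := proj_surjective M N x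
      simp only [LinearMap.comp_apply, LinearMap.id_apply]
      induction w with
      | zero => simp
      | add u v hu hv => simp only [map_add, hu, hv]
      | tmul m m' => rw [rowμInv_rowSingle, rowμ_rowSingle])

@[simp]
theorem rowμIso_rowSingle (M N : RMod k A) (i : n) (m : M) (m' : N) :
    (rowμIso M N).hom.lin (proj _ _ (rowSingle M i m ⊗ₜ rowSingle N i m')) =
      rowSingle _ i (proj M N (m ⊗ₜ m')) := rowμ_rowSingle M N i m m'

variable (k A) in
/-- The element `E_ii` of the unit object, which is the algebra of diagonal scalar matrices. -/
noncomputable def unitGen (i : n) : unitObj k (Matrix n n A) := unitProj k _ (Matrix.single i i 1)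

@[simp]
theorem unitIncl_unitGen (i : n) : unitIncl k _ (unitGen k A i) = Matrix.single i i (1 : A) := by
  rw [unitGen, unitIncl_proj, counitS_single, Bialgebra.counit_one, one_smul]

theorem unitProj_single (i j : n) (a : A) :
    unitProj k _ (Matrix.single i j a) = counit (R := k) a • unitGen k A j := by
  apply unitIncl_injective
  rw [unitIncl_proj, counitS_single, map_smul, unitIncl_unitGen]

theorem unit_ext {V : Type*} [AddCommMonoid V] [Module k V]
    {f g : unitObj k (Matrix n n A) →ₗ[k] V} (h : ∀ i, f (unitGen k A i) = g (unitGen k A i)) :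
    f = g := by
  have key : f ∘ₗ unitProj k (Matrix n n A) = g ∘ₗ unitProj k (Matrix n n A) :=
    matrix_lin_ext fun i j a => by
      simp only [LinearMap.comp_apply, unitProj_single, map_smul, h]
  ext z
  rw [← unitProj_incl z]
  exact LinearMap.congr_fun key _

theorem unitProj_eq_smul (a : A) : unitProj k A a = counit (R := k) a • unitProj k A 1 := by
  apply unitIncl_injective
  rw [map_smul, unitIncl_proj, unitIncl_one, hopf_counitS, Algebra.algebraMap_eq_smul_one]

theorem act_unitGen (i j l : n) (a : A) :
    (unitObj k (Matrix n n A)).act (Matrix.single i j a) (unitGen k A l) =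
      if l = i then counit (R := k) a • unitGen k A j else 0 := by
  rw [unit_act, unitIncl_unitGen, single_mul_single]
  split_ifs
  · rw [one_mul, unitProj_single]
  · simp

variable (k A n) in
/-- The map from diagonal scalar matrices to row vectors of scalars, listing the diagonal. -/
noncomputable def rowε : unitObj k (Matrix n n A) →ₗ[k] rowObj n (unitObj k A) :=
  rowPi fun i => unitProj k A ∘ₗ Matrix.entryLinearMap k A i i ∘ₗ unitIncl k _

@[simp]
theorem rowε_unitGen (i : n) :
    rowε k A n (unitGen k A i) = rowSingle (unitObj k A) i (unitProj k A 1) := by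
  refine row_eval_ext fun j => ?_
  by_cases h : i = j <;> simp [rowε, rowEval_rowSingle, h]

variable (k A n) in
/-- The isomorphism from the unit object, the diagonal scalar matrices, to the row vectors of
scalars. -/
noncomputable def rowεIso : unitObj k (Matrix n n A) ≅ rowObj n (unitObj k A) :=
  isoMk ⟨rowε k A n, fun X z => by
      induction X using Matrix.induction_on' with
      | h_zero => simp
      | h_add p q hp hq => simp only [map_add, LinearMap.add_apply, hp, hq]
      | h_std_basis i j a =>
        suffices h : rowε k A n ∘ₗ (unitObj k (Matrix n n A)).act (Matrix.single i j a) =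
            (rowObj n (unitObj k A)).act (Matrix.single i j a) ∘ₗ rowε k A n from
          LinearMap.congr_fun h z
        refine unit_ext fun l => ?_
        simp only [LinearMap.comp_apply]
        rw [act_unitGen, rowε_unitGen, act_rowSingle]
        split_ifs
        · rw [map_smul, rowε_unitGen, unit_act, unitIncl_one, one_mul, unitProj_eq_smul a, map_smul]
        · simp⟩
    (∑ i, unitProj k _ ∘ₗ Matrix.singleLinearMap k i i ∘ₗ unitIncl k A ∘ₗ rowEval _ i)
    (unit_ext fun i => by
      simp only [LinearMap.comp_apply, LinearMap.sum_apply, rowε_unitGen, LinearMap.id_apply]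
      rw [Finset.sum_eq_single i (fun j _ h => by simp [rowEval_rowSingle, h.symm]) (by simp)]
      rw [rowEval_rowSingle_self, unitIncl_one]
      rfl)
    (row_ext fun i z => by
      simp only [LinearMap.comp_apply, LinearMap.sum_apply, LinearMap.id_apply]
      rw [Finset.sum_eq_single i (fun j _ h => by simp [rowEval_rowSingle, h.symm]) (by simp)]
      rw [rowEval_rowSingle_self, Matrix.singleLinearMap_apply, unitProj_single, map_smul,
        rowε_unitGen, ← map_smul, ← unitProj_eq_smul, unitProj_incl])

@[simp]
theorem rowεIso_unitGen (i : n) : (rowεIso k A n).hom.lin (unitGen k A i) =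
    rowSingle (unitObj k A) i (unitProj k A 1) := rowε_unitGen i

theorem conL_unitGen (i : n) : conL (epsL k (unitIncl k _ (unitGen k A i)))
    (comul (R := k) (1 : Matrix n n A)) = Matrix.single i i 1 := by
  simp [comul_matrix_one, single_mul_single, apply_ite, ite_smul]

/-- Over matrices, `M ⊗̄ N` is the sum of the `M.E_ii ⊗ N.E_ii`: the other summands of `M ⊗ N` are
annihilated by `Δ(1)`. -/
theorem proj_act_of_ne (M N : RMod k (Matrix n n A)) {i j : n} (h : i ≠ j) (x : M) (y : N) :
    proj M N (M.act (Matrix.single i i 1) x ⊗ₜ N.act (Matrix.single j j 1) y) = 0 := by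
  apply incl_injective
  rw [incl_proj, ← pairAct_tmul, ← pairAct_mul, comul_matrix_one, Finset.mul_sum,
    Finset.sum_eq_zero, map_zero, LinearMap.zero_apply, map_zero]
  intro l _
  rw [Algebra.TensorProduct.tmul_mul_tmul, single_mul_single, single_mul_single]
  by_cases hl : i = l
  · subst hl; simp [h.symm]
  · simp [hl]

/-- Equality of maps out of a triple tensor product is tested on tensors of row vectors supported at
one common place. -/
theorem row_tens_ext₃ {M N P : RMod k A} {V : Type*} [AddCommMonoid V] [Module k V]
    {f g : tensorObj (tensorObj (rowObj n M) (rowObj n N)) (rowObj n P) →ₗ[k] V}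
    (h : ∀ i m m' p,
      f (proj _ _ (proj _ _ (rowSingle M i m ⊗ₜ rowSingle N i m') ⊗ₜ rowSingle P i p)) =
      g (proj _ _ (proj _ _ (rowSingle M i m ⊗ₜ rowSingle N i m') ⊗ₜ rowSingle P i p))) :
    f = g := by
  have key : f ∘ₗ proj _ _ = g ∘ₗ proj _ _ := by
    refine TensorProduct.ext <| row_tens_ext fun i m m' => row_ext fun j p => ?_
    simp only [LinearMap.compr₂ₛₗ_apply, TensorProduct.mk_apply, LinearMap.comp_apply]
    by_cases hij : i = j
    · subst hij; exact h i m m' p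
    · have hx : proj _ _ (rowSingle M i m ⊗ₜ rowSingle N i m') =
          (tensorObj (rowObj n M) (rowObj n N)).act (Matrix.single i i 1)
            (proj _ _ (rowSingle M i m ⊗ₜ rowSingle N i m')) := by
        rw [act_proj, pairAct_rowSingle, if_pos ⟨rfl, rfl⟩, pairAct_one, TensorProduct.map_tmul]
      have hy : rowSingle P j p = (rowObj n P).act (Matrix.single j j 1) (rowSingle P j p) := by
        rw [act_rowSingle, if_pos rfl, P.act_one]
      rw [hx, hy, proj_act_of_ne _ _ hij, map_zero, map_zero]
  ext x
  obtain ⟨w, rfl⟩ := proj_surjective _ _ x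
  exact LinearMap.congr_fun key w

theorem unit_row_ext {M : RMod k A} {V : Type*} [AddCommMonoid V] [Module k V]
    {f g : tensorObj (unitObj k (Matrix n n A)) (rowObj n M) →ₗ[k] V}
    (h : ∀ i j m, f (proj _ _ (unitGen k A i ⊗ₜ rowSingle M j m)) =
      g (proj _ _ (unitGen k A i ⊗ₜ rowSingle M j m))) : f = g := by
  have key : f ∘ₗ proj _ _ = g ∘ₗ proj _ _ :=
    TensorProduct.ext <| unit_ext fun i => row_ext fun j m => h i j m
  exact tens_ext fun z v => LinearMap.congr_fun key (z ⊗ₜ v)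

theorem row_unit_ext {M : RMod k A} {V : Type*} [AddCommMonoid V] [Module k V]
    {f g : tensorObj (rowObj n M) (unitObj k (Matrix n n A)) →ₗ[k] V}
    (h : ∀ i m j, f (proj _ _ (rowSingle M i m ⊗ₜ unitGen k A j)) =
      g (proj _ _ (rowSingle M i m ⊗ₜ unitGen k A j))) : f = g := by
  have key : f ∘ₗ proj _ _ = g ∘ₗ proj _ _ :=
    TensorProduct.ext <| row_ext fun i m => unit_ext fun j => h i m j
  exact tens_ext fun v z => LinearMap.congr_fun key (v ⊗ₜ z)

variable (k A n) in
/-- The row vector functor is a tensor functor. -/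
noncomputable def rowCore : (row k A n).CoreMonoidal where
  εIso := rowεIso k A n
  μIso M N := rowμIso M N
  μIso_hom_natural_left {M N} f P := hom_ext (row_tens_ext fun i m p => by
    change (rowμIso N P).hom.lin ((tensorMap (rowMap n f) (𝟙 (rowObj n P))).lin
        (proj _ _ (rowSingle M i m ⊗ₜ rowSingle P i p))) =
      (rowMap n (tensorMap f (𝟙 P))).lin ((rowμIso M P).hom.lin
        (proj _ _ (rowSingle M i m ⊗ₜ rowSingle P i p)))
    simp)
  μIso_hom_natural_right {M N} P f := hom_ext (row_tens_ext fun i p m => by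
    change (rowμIso P N).hom.lin ((tensorMap (𝟙 (rowObj n P)) (rowMap n f)).lin
        (proj _ _ (rowSingle P i p ⊗ₜ rowSingle M i m))) =
      (rowMap n (tensorMap (𝟙 P) f)).lin ((rowμIso P M).hom.lin
        (proj _ _ (rowSingle P i p ⊗ₜ rowSingle M i m)))
    simp)
  associativity M N P := hom_ext (row_tens_ext₃ fun i m m' p => by
    change (rowMap n (assocIso M N P).hom).lin ((rowμIso (tensorObj M N) P).hom.lin
        ((tensorMap (rowμIso M N).hom (𝟙 (rowObj n P))).lin
          (proj _ _ (proj _ _ (rowSingle M i m ⊗ₜ rowSingle N i m') ⊗ₜ rowSingle P i p)))) =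
      (rowμIso M (tensorObj N P)).hom.lin
        ((tensorMap (𝟙 (rowObj n M)) (rowμIso N P).hom).lin
          ((assocIso (rowObj n M) (rowObj n N) (rowObj n P)).hom.lin
            (proj _ _ (proj _ _ (rowSingle M i m ⊗ₜ rowSingle N i m') ⊗ₜ rowSingle P i p))))
    simp)
  left_unitality M := hom_ext (unit_row_ext fun i j m => by
    change (leftIso (rowObj n M)).hom.lin (proj _ _ (unitGen k A i ⊗ₜ rowSingle M j m)) =
      (rowMap n (leftIso M).hom).lin ((rowμIso (unitObj k A) M).hom.lin
        ((tensorMap (rowεIso k A n).hom (𝟙 (rowObj n M))).lin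
          (proj _ _ (unitGen k A i ⊗ₜ rowSingle M j m))))
    rw [leftIso_hom_proj, conL_unitGen, act_rowSingle, tensorMap_proj_tmul, rowεIso_unitGen,
      id_lin, LinearMap.id_apply]
    by_cases h : i = j
    · subst h
      rw [if_pos rfl, rowμIso_rowSingle, rowMap_rowSingle, leftIso_hom_proj, unitIncl_one,
        show epsL k (1 : A) = counit (R := k) by ext; simp, conL_counit_comul]
    · rw [proj_rowSingle_of_ne _ _ h, if_neg (Ne.symm h), map_zero, map_zero])
  right_unitality M := hom_ext (row_unit_ext fun i m j => by
    change (rightIso (rowObj n M)).hom.lin (proj _ _ (rowSingle M i m ⊗ₜ unitGen k A j)) =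
      (rowMap n (rightIso M).hom).lin ((rowμIso M (unitObj k A)).hom.lin
        ((tensorMap (𝟙 (rowObj n M)) (rowεIso k A n).hom).lin
          (proj _ _ (rowSingle M i m ⊗ₜ unitGen k A j))))
    rw [rightIso_hom_proj, unitIncl_unitGen, act_rowSingle, tensorMap_proj_tmul, rowεIso_unitGen,
      id_lin, LinearMap.id_apply]
    by_cases h : i = j
    · subst h
      rw [if_pos rfl, rowμIso_rowSingle, rowMap_rowSingle, rightIso_hom_proj, unitIncl_one]
    · rw [proj_rowSingle_of_ne _ _ h, if_neg h, map_zero, map_zero])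

noncomputable instance : (row k A n).Monoidal := (rowCore k A n).toMonoidal

end RowTensor

end RMod

/-! ### The strict action on matrices -/

namespace WeakAction

variable {k G A : Type u} [Field k] [Group G] [Ring A] [Algebra k A] (α : WeakAction k G A)

theorem c_one_left (h : G) : α.c 1 h = 1 := by
  have e := α.cocycle 1 1 h
  rw [α.c_one_one, one_mul, one_mul, Units.val_one, one_mul] at e
  have e' := congrArg (fun y : A => y * ((α.c 1 h)⁻¹ : Aˣ)) e
  exact Units.ext ((α.φ 1).injective (by simpa using e'))

theorem c_one_right (g : G) : α.c g 1 = 1 := by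
  have e := α.cocycle g 1 1
  rw [α.c_one_one, Units.val_one, map_one, one_mul, mul_one, mul_one] at e
  exact (mul_eq_left.1 (Units.ext e.symm))

theorem φ_one (a : A) : α.φ 1 a = a := by
  have e := α.φ_φ 1 1 a
  rw [α.c_one_one, mul_one, inv_one, Units.val_one, one_mul, mul_one] at e
  exact (α.φ 1).injective e

/-- The cocycle condition, solved for a factor. -/
theorem φ_c (g h l : G) : α.φ g (α.c h l) = α.c g h * α.c (g * h) l * ((α.c g (h * l))⁻¹ : Aˣ) := by
  rw [← α.cocycle, mul_assoc, Units.mul_inv, mul_one]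

theorem φ_c_inv (g h l : G) : α.φ g ((α.c h l)⁻¹ : Aˣ) =
    α.c g (h * l) * ((α.c (g * h) l)⁻¹ : Aˣ) * ((α.c g h)⁻¹ : Aˣ) := by
  have e : Units.map (α.φ g : A →* A) (α.c h l) =
      α.c g h * α.c (g * h) l * (α.c g (h * l))⁻¹ := Units.ext (by simpa using α.φ_c g h l)
  have e' := congrArg (fun u : Aˣ => ((u⁻¹ : Aˣ) : A)) e
  simpa [mul_assoc] using e'

variable [Fintype G] [DecidableEq G]

/-- The automorphism `a E_ij ↦ c_{x,i}⁻¹ φ_x(a) c_{x,j} E_{xi,xj}` of the algebra of matrices: the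
entrywise `φ_x`, followed by the permutation of the places, and conjugated by a diagonal matrix of
compositors. -/
noncomputable def matrixHom (x : G) : Matrix G G A →ₐ[k] Matrix G G A :=
  AlgHom.ofLinearMap
    { toFun X := Matrix.of fun i j => ((α.c x (x⁻¹ * i))⁻¹ : Aˣ) * α.φ x (X (x⁻¹ * i) (x⁻¹ * j)) *
        α.c x (x⁻¹ * j)
      map_add' X Y := by ext; simp [mul_add, add_mul]
      map_smul' c X := by ext; simp }
    (by
      ext i j
      by_cases h : i = j
      · subst h; simp
      · simp [Matrix.one_apply, h])
    (fun X Y => by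
      ext i j
      simp only [LinearMap.coe_mk, AddHom.coe_mk, Matrix.of_apply, Matrix.mul_apply, map_sum,
        map_mul, Finset.mul_sum, Finset.sum_mul]
      refine Fintype.sum_equiv (Equiv.mulLeft x) _ _ fun l => ?_
      simp [mul_assoc])

theorem matrixHom_apply (x i j : G) (X : Matrix G G A) : α.matrixHom x X i j =
    ((α.c x (x⁻¹ * i))⁻¹ : Aˣ) * α.φ x (X (x⁻¹ * i) (x⁻¹ * j)) * α.c x (x⁻¹ * j) := rfl

theorem matrixHom_single (x i j : G) (a : A) : α.matrixHom x (Matrix.single i j a) =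
    Matrix.single (x * i) (x * j) (((α.c x i)⁻¹ : Aˣ) * α.φ x a * α.c x j) := by
  ext l m
  rw [matrixHom_apply, Matrix.single_apply, Matrix.single_apply]
  by_cases hl : x * i = l
  · by_cases hm : x * j = m
    · subst hl hm; simp
    · simp [hm, eq_inv_mul_iff_mul_eq]
  · simp [hl, eq_inv_mul_iff_mul_eq]

/-- The cocycle condition makes the action on matrices strict: the compositors coming from
`φ_x φ_y` cancel against those of the diagonal conjugation. -/
theorem matrixHom_matrixHom (x y : G) (X : Matrix G G A) :
    α.matrixHom x (α.matrixHom y X) = α.matrixHom (x * y) X := by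
  induction X using Matrix.induction_on' with
  | h_zero => simp
  | h_add p q hp hq => simp only [map_add, hp, hq]
  | h_std_basis i j a =>
    simp only [matrixHom_single, map_mul, φ_c, φ_c_inv, φ_φ, mul_assoc, Units.inv_mul_cancel_left]
    simp

theorem matrixHom_one (X : Matrix G G A) : α.matrixHom 1 X = X := by
  ext i j
  simp [matrixHom_apply, c_one_left, φ_one]

/-- The automorphism `matrixHom x`, whose inverse is `matrixHom x⁻¹` by strictness. -/
noncomputable def matrixEquiv (x : G) : Matrix G G A ≃ₐ[k] Matrix G G A :=
  AlgEquiv.ofAlgHom (α.matrixHom x) (α.matrixHom x⁻¹)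
    (AlgHom.ext fun X => by simp [matrixHom_matrixHom, matrixHom_one])
    (AlgHom.ext fun X => by simp [matrixHom_matrixHom, matrixHom_one])

theorem matrixEquiv_apply (x : G) (X : Matrix G G A) :
    α.matrixEquiv x X = α.matrixHom x X := rfl

end WeakAction

namespace HopfAction

variable {k G A : Type u} [Field k] [Group G] [Ring A] [HopfAlgebra k A] (α : HopfAction k G A)

theorem isGroupLikeElem_c (g h : G) : IsGroupLikeElem k (α.c g h : A) where
  counit_eq_one := by
    have e := conL_counit_comul (k := k) (α.c g h : A)
    rw [α.comul_c_hopf, conL_tmul] at e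
    have e' := congrArg (fun y : A => counit (R := k) (y * ((α.c g h)⁻¹ : Aˣ))) e
    simpa using e'
  comul_eq_tmul_self := α.comul_c_hopf g h

theorem isGroupLikeElem_c_inv (g h : G) : IsGroupLikeElem k ((α.c g h)⁻¹ : Aˣ).val :=
  isGroupLikeElem_unitsInv.2 (α.isGroupLikeElem_c g h)

theorem antipode_c (g h : G) : HopfAlgebra.antipode k (α.c g h : A) = ((α.c g h)⁻¹ : Aˣ) :=
  (Units.inv_eq_of_mul_eq_one_right (α.isGroupLikeElem_c g h).mul_antipode_cancel).symm

theorem antipode_c_inv (g h : G) :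
    HopfAlgebra.antipode k (((α.c g h)⁻¹ : Aˣ) : A) = α.c g h := by
  rw [← antipode_c, (α.isGroupLikeElem_c g h).antipode_antipode]

variable [Fintype G] [DecidableEq G]

/-- The strict action of `G` on matrices obtained from a weak action on `A`. -/
noncomputable def matrixAction : HopfAction k G (Matrix G G A) where
  φ := α.matrixEquiv
  c _ _ := 1
  φ_φ g h X := by simp [WeakAction.matrixEquiv_apply, WeakAction.matrixHom_matrixHom]
  cocycle _ _ _ := by simp
  c_one_one := rfl
  comul_φ g X := by
    induction X using Matrix.induction_on' with
    | h_zero => simp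
    | h_add p q hp hq => simp only [map_add, hp, hq]
    | h_std_basis i j a =>
      rw [WeakAction.matrixEquiv_apply, WeakAction.matrixHom_single, comul_single, comul_single,
        Bialgebra.comul_mul, Bialgebra.comul_mul, α.comul_c_hopf,
        (α.isGroupLikeElem_c_inv g i).comul_eq_tmul_self, α.comul_φ]
      generalize comul (R := k) a = X
      induction X with
      | zero => simp
      | add u v hu hv => simp only [map_add, mul_add, add_mul, hu, hv]
      | tmul u v => simp [WeakAction.matrixEquiv_apply, WeakAction.matrixHom_single]
  counit_φ g X := by
    induction X using Matrix.induction_on' with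
    | h_zero => simp
    | h_add p q hp hq => simp only [map_add, hp, hq]
    | h_std_basis i j a =>
      rw [WeakAction.matrixEquiv_apply, WeakAction.matrixHom_single, counit_single, counit_single,
        Bialgebra.counit_mul, Bialgebra.counit_mul, (α.isGroupLikeElem_c_inv g i).counit_eq_one,
        (α.isGroupLikeElem_c g j).counit_eq_one, α.counit_φ, one_mul, mul_one]
  antipode_φ g X := by
    change matrixAntipode _ = α.matrixEquiv g (matrixAntipode X)
    induction X using Matrix.induction_on' with
    | h_zero => simp
    | h_add p q hp hq => simp only [map_add, hp, hq]
    | h_std_basis i j a =>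
      rw [WeakAction.matrixEquiv_apply, WeakAction.matrixEquiv_apply, WeakAction.matrixHom_single,
        matrixAntipode_single, matrixAntipode_single, WeakAction.matrixHom_single,
        HopfAlgebra.antipode_mul_antidistrib, HopfAlgebra.antipode_mul_antidistrib, antipode_c,
        antipode_c_inv, mul_assoc]
      exact congrArg (fun y => Matrix.single _ _ (_ * (y * _))) (α.antipode_φ g a)
  comul_c _ _ := by simp [← Algebra.TensorProduct.one_def]

theorem matrixAction_isStrict : α.matrixAction.IsStrict := fun _ _ => rfl

theorem matrixAction_φ_single (x i j : G) (a : A) : α.matrixAction.φ x (Matrix.single i j a) =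
    Matrix.single (x * i) (x * j) (((α.c x i)⁻¹ : Aˣ) * α.φ x a * α.c x j) :=
  α.matrixHom_single x i j a

/-- The equivariance map `(ᵍM)^G → ᵍ(M^G)`, which sends the row vector with entry `m` at the place
`x` to the one with entry `m.c_{g⁻¹,x}` at the place `g⁻¹x`. -/
noncomputable def rowψLin (g : G) (M : RMod k A) :
    RMod.rowObj G (α.twistObj g M) →ₗ[k] RMod.rowObj G M :=
  RMod.rowPi fun y => M.act (α.c g⁻¹ (g * y)) ∘ₗ RMod.rowEval (α.twistObj g M) (g * y)

theorem rowψLin_rowSingle (g x : G) (M : RMod k A) (m : M) :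
    α.rowψLin g M (RMod.rowSingle (α.twistObj g M) x m) =
      RMod.rowSingle M (g⁻¹ * x) (M.act (α.c g⁻¹ x) m) := by
  refine RMod.row_eval_ext fun y => ?_
  simp only [rowψLin, RMod.rowEval_rowPi, LinearMap.comp_apply, RMod.rowEval_rowSingle]
  by_cases h : x = g * y
  · subst h; simp
  · rw [if_neg h, if_neg (fun H => h (by rw [← H, mul_inv_cancel_left])), map_zero]

/-- The morphism `(ᵍM)^G → ᵍ(M^G)`. -/
noncomputable def rowψHom (g : G) (M : RMod k A) :
    RMod.rowObj G (α.twistObj g M) ⟶ α.matrixAction.twistObj g (RMod.rowObj G M) where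
  lin := α.rowψLin g M
  comm X v := by
    induction X using Matrix.induction_on' with
    | h_zero => simp
    | h_add p q hp hq => simp only [map_add, LinearMap.add_apply, hp, hq]
    | h_std_basis i j a =>
      suffices h : α.rowψLin g M ∘ₗ (RMod.rowObj G (α.twistObj g M)).act (Matrix.single i j a) =
          (RMod.rowObj G M).act (α.matrixAction.φ g⁻¹ (Matrix.single i j a)) ∘ₗ α.rowψLin g M from
        LinearMap.congr_fun h v
      refine RMod.row_ext fun x m => ?_
      simp only [LinearMap.comp_apply]
      rw [RMod.act_rowSingle, matrixAction_φ_single, rowψLin_rowSingle, RMod.act_rowSingle]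
      by_cases h : x = i
      · subst h
        rw [if_pos rfl, if_pos rfl, rowψLin_rowSingle, ← M.act_mul]
        change RMod.rowSingle M _ (M.act _ (M.act (α.φ g⁻¹ a) m)) = _
        rw [← M.act_mul]
        simp [mul_assoc]
      · rw [if_neg h, if_neg (fun H => h (mul_left_cancel H)), map_zero]

/-- The isomorphism `(ᵍM)^G ≅ ᵍ(M^G)`. -/
noncomputable def rowψIso (g : G) (M : RMod k A) :
    RMod.rowObj G (α.twistObj g M) ≅ α.matrixAction.twistObj g (RMod.rowObj G M) :=
  RMod.isoMk (α.rowψHom g M)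
    (RMod.rowPi (M := α.twistObj g M) fun x =>
      M.act ((α.c g⁻¹ x)⁻¹ : Aˣ) ∘ₗ RMod.rowEval M (g⁻¹ * x))
    (by
      ext v
      refine RMod.row_eval_ext fun x => ?_
      change M.act ((α.c g⁻¹ x)⁻¹ : Aˣ) (M.act (α.c g⁻¹ (g * (g⁻¹ * x)))
        (RMod.rowEval (α.twistObj g M) (g * (g⁻¹ * x)) v)) = _
      rw [← M.act_mul, mul_inv_cancel_left, Units.mul_inv, M.act_one]
      rfl)
    (by
      ext v
      refine RMod.row_eval_ext fun x => ?_
      change M.act (α.c g⁻¹ (g * x)) (M.act ((α.c g⁻¹ (g * x))⁻¹ : Aˣ)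
        (RMod.rowEval M (g⁻¹ * (g * x)) v)) = _
      rw [← M.act_mul, inv_mul_cancel_left, Units.inv_mul, M.act_one]
      rfl)

/-- The equivariance isomorphisms are natural. -/
noncomputable def rowψ (g : G) :
    α.twist g ⋙ RMod.row k A G ≅ RMod.row k A G ⋙ α.matrixAction.twist g :=
  NatIso.ofComponents (fun M => α.rowψIso g M) fun {M N} f =>
    RMod.hom_ext (RMod.row_ext fun x m => by
      change α.rowψLin g N ((RMod.rowMap G ((α.twist g).map f)).lin
          (RMod.rowSingle (α.twistObj g M) x m)) =
        (RMod.rowMap G f).lin (α.rowψLin g M (RMod.rowSingle (α.twistObj g M) x m))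
      rw [RMod.rowMap_rowSingle, rowψLin_rowSingle, rowψLin_rowSingle, RMod.rowMap_rowSingle,
        f.comm])

/-- The equivariance isomorphisms are monoidal because the compositors are grouplike. -/
theorem rowψ_isMonoidal (g : G) : NatTrans.IsMonoidal (α.rowψ g).hom where
  unit := RMod.hom_ext (RMod.unit_ext fun i => by
    change α.rowψLin g (RMod.unitObj k A) ((RMod.rowMap G (α.twistεIso g).hom).lin
        ((RMod.rowεIso k A G).hom.lin (RMod.unitGen k A i))) =
      (RMod.rowεIso k A G).hom.lin ((α.matrixAction.twistεIso g).hom.lin (RMod.unitGen k A i))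
    have hl : (α.twistεIso g).hom.lin (RMod.unitProj k A 1) = RMod.unitProj k A 1 := by
      rw [twistεIso_apply, RMod.unitIncl_one, map_one]
    have hr : (α.matrixAction.twistεIso g).hom.lin (RMod.unitGen k A i) =
        RMod.unitGen k A (g⁻¹ * i) := by
      rw [twistεIso_apply, RMod.unitIncl_unitGen, matrixAction_φ_single, map_one, mul_one,
        Units.inv_mul, RMod.unitGen]
    rw [hr, RMod.rowεIso_unitGen, RMod.rowεIso_unitGen]
    refine (congrArg (α.rowψLin g _) (RMod.rowMap_rowSingle _ i _)).trans ?_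
    rw [hl]
    refine (α.rowψLin_rowSingle g i (RMod.unitObj k A) _).trans ?_
    rw [RMod.unit_act, RMod.unitIncl_one, one_mul, RMod.unitProj_eq_smul,
      (α.isGroupLikeElem_c _ _).counit_eq_one, one_smul])
  tensor M N := RMod.hom_ext (RMod.row_tens_ext fun i m m' => by
    change α.rowψLin g (RMod.tensorObj M N) ((RMod.rowMap G (α.twistμIso g M N).hom).lin
        ((RMod.rowμIso (α.twistObj g M) (α.twistObj g N)).hom.lin
          (RMod.proj _ _ (RMod.rowSingle (α.twistObj g M) i m ⊗ₜ
            RMod.rowSingle (α.twistObj g N) i m')))) =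
      (RMod.rowμIso M N).hom.lin ((α.matrixAction.twistμIso g (RMod.rowObj G M)
        (RMod.rowObj G N)).hom.lin ((RMod.tensorMap (α.rowψHom g M) (α.rowψHom g N)).lin
          (RMod.proj _ _ (RMod.rowSingle (α.twistObj g M) i m ⊗ₜ
            RMod.rowSingle (α.twistObj g N) i m'))))
    rw [RMod.rowμIso_rowSingle, RMod.tensorMap_proj_tmul]
    refine (congrArg (α.rowψLin g _) (RMod.rowMap_rowSingle _ i _)).trans ?_
    rw [twistμIso_proj]
    refine (α.rowψLin_rowSingle g i (RMod.tensorObj M N) _).trans ?_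
    rw [RMod.act_proj, α.comul_c_hopf, RMod.pairAct_tmul]
    refine Eq.trans ?_ (congrArg (RMod.rowμIso M N).hom.lin
      (α.matrixAction.twistμIso_proj g (RMod.rowObj G M) (RMod.rowObj G N) _ _)).symm
    refine (RMod.rowμIso_rowSingle M N (g⁻¹ * i) _ _).symm.trans ?_
    rw [← rowψLin_rowSingle, ← rowψLin_rowSingle]
    rfl)

/-- The compositors of the action on matrices are trivial, so the compatibility of the equivariance
isomorphisms with compositors is exactly the cocycle condition. -/
theorem rowψ_coherence (g h : G) (M : RMod k A) :
    (α.rowψ g).hom.app ((α.twist h).obj M) ≫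
        (α.matrixAction.twist g).map ((α.rowψ h).hom.app M) ≫
        (α.matrixAction.compositor g h).hom.app ((RMod.row k A G).obj M) =
      (RMod.row k A G).map ((α.compositor g h).hom.app M) ≫ (α.rowψ (g * h)).hom.app M :=
  RMod.hom_ext (RMod.row_ext fun x m => by
    change (RMod.rowObj G M).act 1 (α.rowψLin h M (α.rowψLin g (α.twistObj h M)
        (RMod.rowSingle (α.twistObj g (α.twistObj h M)) x m))) =
      α.rowψLin (g * h) M ((RMod.rowMap G ((α.compositor g h).hom.app M)).lin
        (RMod.rowSingle (α.twistObj g (α.twistObj h M)) x m))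
    rw [RMod.act_one, rowψLin_rowSingle, rowψLin_rowSingle]
    refine Eq.trans ?_ ((congrArg (α.rowψLin (g * h) M) (RMod.rowMap_rowSingle _ x m)).trans
      (α.rowψLin_rowSingle (g * h) x M _)).symm
    change RMod.rowSingle M _ (M.act _ (M.act (α.φ h⁻¹ _) m)) =
      RMod.rowSingle M _ (M.act _ (M.act _ m))
    rw [← M.act_mul, ← M.act_mul, α.cocycle, mul_inv_rev, mul_assoc])

/-- The equivalence between modules over `A` and over matrices, given by row vectors. -/
noncomputable def rowEquivalence : EquivariantEquivalence α α.matrixAction where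
  F := RMod.row k A G
  isEquivalence := RMod.row_isEquivalence
  linear := inferInstance
  finiteDimensional_iff := RMod.finiteDimensional_rowObj_iff
  ψ := α.rowψ
  ψ_monoidal := α.rowψ_isMonoidal
  ψ_coherence := α.rowψ_coherence

/-- The strictification by matrices. -/
noncomputable def matrixStrictification : Strictification α where
  B := Matrix G G A
  β := α.matrixAction
  isStrict := α.matrixAction_isStrict
  equiv := α.rowEquivalence

end HopfAction

/-! ### Gradings on matrices -/

namespace Grading

section Ideal

variable {k G A : Type u} [Field k] [Group G] [Ring A] [Algebra k A] [Coalgebra k A]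
  [WeakHopfAlgebra k A] {α : HopfAction k G A} (𝒜 : Grading α)

/-- The homogeneous components of an algebra graded as a direct product are ideals. -/
theorem mul_mem_left {g : G} {a : A} (b : A) (ha : a ∈ 𝒜.comp g) : b * a ∈ 𝒜.comp g := by
  have hb : b ∈ iSup 𝒜.comp := by rw [𝒜.iSup_eq_top]; trivial
  induction hb using Submodule.iSup_induction' with
  | mem h b hb =>
    by_cases e : h = g
    · subst e; exact 𝒜.mul_mem _ _ hb _ ha
    · rw [𝒜.mul_eq_zero _ _ e _ hb _ ha]; exact zero_mem _
  | zero => simp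
  | add x y _ _ hx hy => rw [add_mul]; exact add_mem hx hy

theorem mul_mem_right {g : G} {a : A} (b : A) (ha : a ∈ 𝒜.comp g) : a * b ∈ 𝒜.comp g := by
  have hb : b ∈ iSup 𝒜.comp := by rw [𝒜.iSup_eq_top]; trivial
  induction hb using Submodule.iSup_induction' with
  | mem h b hb =>
    by_cases e : h = g
    · subst e; exact 𝒜.mul_mem _ _ ha _ hb
    · rw [𝒜.mul_eq_zero _ _ (Ne.symm e) _ ha _ hb]; exact zero_mem _
  | zero => simp
  | add x y _ _ hx hy => rw [mul_add]; exact add_mem hx hy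

end Ideal

variable {k G A : Type u} [Field k] [Group G] [Ring A] [HopfAlgebra k A] {α : HopfAction k G A}
  (𝒜 : Grading α)

/-- The matrices with entries in `A_g`. -/
def matrixComp (g : G) : Submodule k (Matrix G G A) where
  carrier := {X | ∀ i j, X i j ∈ 𝒜.comp g}
  add_mem' hX hY i j := add_mem (hX i j) (hY i j)
  zero_mem' _ _ := zero_mem _
  smul_mem' c _ hX i j := Submodule.smul_mem _ c (hX i j)

theorem iSup_matrixComp_le {ι : Type*} (f : ι → G) (i j : G) :
    ⨆ l, 𝒜.matrixComp (f l) ≤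
      (⨆ l, 𝒜.comp (f l)).comap (Matrix.entryLinearMap k A i j) :=
  iSup_le fun l _ hX => Submodule.mem_iSup_of_mem l (hX i j)

variable [DecidableEq G]

theorem single_mem_matrixComp (i j : G) {g : G} {a : A} (ha : a ∈ 𝒜.comp g) :
    Matrix.single i j a ∈ 𝒜.matrixComp g := fun i' j' => by
  rw [Matrix.single_apply]
  split_ifs
  exacts [ha, zero_mem _]

variable [Fintype G]

/-- The grading of matrices by the degrees of their entries. -/
noncomputable def matrixGrading : Grading α.matrixAction where
  comp := 𝒜.matrixComp
  indep g := by
    rw [Submodule.disjoint_def]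
    intro X hX hX'
    ext i j
    refine Submodule.disjoint_def.1 (𝒜.indep g) _ (hX i j) ?_
    rw [iSup_subtype'] at hX' ⊢
    exact 𝒜.iSup_matrixComp_le (fun l : {h // h ≠ g} => l.1) i j hX'
  iSup_eq_top := by
    refine Submodule.eq_top_iff'.2 fun X => ?_
    induction X using Matrix.induction_on' with
    | h_zero => exact zero_mem _
    | h_add p q hp hq => exact add_mem hp hq
    | h_std_basis i j a =>
      have ha : a ∈ iSup 𝒜.comp := by rw [𝒜.iSup_eq_top]; trivial
      induction ha using Submodule.iSup_induction' with
      | mem g a ha => exact Submodule.mem_iSup_of_mem g (𝒜.single_mem_matrixComp i j ha)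
      | zero => simp
      | add x y _ _ hx hy => rw [Matrix.single_add]; exact add_mem hx hy
  mul_mem g X hX Y hY i j := by
    rw [Matrix.mul_apply]
    exact sum_mem fun l _ => 𝒜.mul_mem g _ (hX i l) _ (hY l j)
  mul_eq_zero g h hgh X hX Y hY := by
    ext i j
    rw [Matrix.mul_apply]
    exact Finset.sum_eq_zero fun l _ => 𝒜.mul_eq_zero g h hgh _ (hX i l) _ (hY l j)
  φ_mem g h X hX i j :=
    𝒜.mul_mem_right _ (𝒜.mul_mem_left _ (𝒜.φ_mem g h _ (hX _ _)))
  comul_mem g X hX := by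
    rw [Matrix.matrix_eq_sum_single X]
    simp only [map_sum]
    refine sum_mem fun i _ => sum_mem fun j _ => ?_
    have h := Submodule.mem_map_of_mem
      (f := TensorProduct.map (Matrix.singleLinearMap k i j) (Matrix.singleLinearMap k i j))
      (𝒜.comul_mem g _ (hX i j))
    rw [comul_single]
    refine SetLike.le_def.1 ?_ h
    simp only [Submodule.map_iSup]
    refine iSup_mono fun p => iSup_mono fun q => iSup_mono fun _ => ?_
    rintro _ ⟨_, ⟨w, rfl⟩, rfl⟩
    induction w with
    | zero => simp
    | add u v hu hv => simp only [map_add]; exact add_mem hu hv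
    | tmul a b =>
      exact ⟨⟨_, 𝒜.single_mem_matrixComp i j a.2⟩ ⊗ₜ ⟨_, 𝒜.single_mem_matrixComp i j b.2⟩, rfl⟩

theorem matrixGrading_inDegree_iff (h : G) (M : RMod k A) :
    𝒜.matrixGrading.InDegree h (RMod.rowObj G M) ↔ 𝒜.InDegree h M := by
  refine ⟨fun H g hg a ha m => ?_, fun H g hg X hX v => ?_⟩
  · have e := congrArg (RMod.rowEval M 1)
      (H g hg _ (𝒜.single_mem_matrixComp 1 1 ha) (RMod.rowSingle M 1 m))
    simpa [RMod.act_rowSingle] using e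
  · refine RMod.row_eval_ext fun j => ?_
    rw [RMod.rowEval_act, map_zero]
    exact Finset.sum_eq_zero fun i _ => H g hg _ (hX i j) _

/-- The strictification by matrices, graded by the degrees of the entries. -/
noncomputable def matrixStrictification : GradedStrictification α 𝒜 where
  toStrictification := α.matrixStrictification
  grading := 𝒜.matrixGrading
  inDegree_iff := 𝒜.matrixGrading_inDegree_iff

end Grading

/-! ### Matrices as `K(G) ⊗ A ⊗ K[G]` -/

/-- `M ⊗ K[G]` as the space of functions on `G` with values in `M`. -/
noncomputable def tensorGroupAlgebra (k G M : Type*) [Field k] [Fintype G] [DecidableEq G]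
    [AddCommGroup M] [Module k M] : M ⊗[k] MonoidAlgebra k G ≃ₗ[k] (G → M) :=
  (TensorProduct.congr (LinearEquiv.refl k M) ((MonoidAlgebra.coeffLinearEquiv k).trans
    (Finsupp.linearEquivFunOnFinite k k G))).trans (TensorProduct.piScalarRight k k M G)

theorem tensorGroupAlgebra_tmul {k G M : Type*} [Field k] [Fintype G] [DecidableEq G]
    [AddCommGroup M] [Module k M] (m : M) (y : MonoidAlgebra k G) (x : G) :
    tensorGroupAlgebra k G M (m ⊗ₜ y) x = y.coeff x • m := by
  rw [tensorGroupAlgebra, LinearEquiv.trans_apply, TensorProduct.congr_tmul,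
    TensorProduct.piScalarRight_apply, TensorProduct.piScalarRightHom_tmul]
  rfl

namespace HopfAction

variable {k G A : Type u} [Field k] [Group G] [Fintype G] [DecidableEq G] [Ring A]
  [HopfAlgebra k A] (α : HopfAction k G A)

/-- The element `δ_g ⊗ a ⊗ h` of the algebra of matrices. It sends the row vector with entry `m` at
the place `gh⁻¹` to the one with entry `m.φ_{gh⁻¹}(a)c_{gh⁻¹,h}` at the place `g`. -/
noncomputable def stdGen (g h : G) : A →ₗ[k] Matrix G G A :=
  Matrix.singleLinearMap k (g * h⁻¹) g ∘ₗ LinearMap.mulRight k (α.c (g * h⁻¹) h : A) ∘ₗ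
    (α.φ (g * h⁻¹)).toLinearMap

theorem stdGen_apply (g h : G) (a : A) : α.stdGen g h a =
    Matrix.single (g * h⁻¹) g (α.φ (g * h⁻¹) a * α.c (g * h⁻¹) h) := rfl

/-- The identification of `K(G) ⊗ A ⊗ K[G]` with the algebra of matrices: with `f g h` the
coefficient in `A` of `δ_g ⊗ _ ⊗ h`, the place `(i, j)` carries the coefficient of
`δ_j ⊗ _ ⊗ i⁻¹j`, twisted by the automorphism `a ↦ φ_i(a) c_{i,i⁻¹j}` of the vector space `A`. -/
noncomputable def stdEquiv : (G → k) ⊗[k] (A ⊗[k] MonoidAlgebra k G) ≃ₗ[k] Matrix G G A :=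
  (TensorProduct.congr (LinearEquiv.refl k _) (tensorGroupAlgebra k G A)).trans <|
  (TensorProduct.comm k _ _).trans <|
  (TensorProduct.piScalarRight k k (G → A) G).trans
  { toFun f := Matrix.of fun i j => α.φ i (f j (i⁻¹ * j)) * α.c i (i⁻¹ * j)
    map_add' f f' := by ext; simp [add_mul]
    map_smul' c f := by ext; simp
    invFun X g h := (α.φ (g * h⁻¹)).symm (X (g * h⁻¹) g * ((α.c (g * h⁻¹) h)⁻¹ : Aˣ))
    left_inv f := by ext; simp
    right_inv X := by ext; simp [mul_assoc] }

theorem stdEquiv_tmul (f : G → k) (a : A) (y : MonoidAlgebra k G) (i j : G) :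
    α.stdEquiv (f ⊗ₜ (a ⊗ₜ y)) i j =
      (f j * y.coeff (i⁻¹ * j)) • (α.φ i a * α.c i (i⁻¹ * j)) := by
  simp only [stdEquiv, LinearEquiv.trans_apply, TensorProduct.congr_tmul,
    TensorProduct.comm_tmul, TensorProduct.piScalarRight_apply,
    TensorProduct.piScalarRightHom_tmul]
  simp [tensorGroupAlgebra_tmul, smul_smul]

theorem stdGen_eq (g h : G) (a : A) : α.stdGen g h a =
    α.stdEquiv (Pi.single g 1 ⊗ₜ[k] (a ⊗ₜ[k] MonoidAlgebra.single h (1 : k))) := by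
  ext i j
  rw [stdEquiv_tmul, stdGen_apply, Matrix.single_apply]
  by_cases hj : g = j
  · subst hj
    by_cases hi : g * h⁻¹ = i
    · subst hi; simp
    · have hi' : h ≠ i⁻¹ * g := fun H => hi (by rw [H]; group)
      simp [hi, hi']
  · simp [hj, Ne.symm hj]

theorem stdGen_mul_stdGen (g h g' h' : G) (a a' : A) : α.stdGen g h a * α.stdGen g' h' a' =
    if g * h' = g' then α.stdGen g' (h * h') (a * α.φ h a' * (α.c h h' : A)) else 0 := by
  obtain ⟨x, rfl⟩ : ∃ x, g = x * h := ⟨g * h⁻¹, by simp⟩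
  simp only [stdGen_apply, single_mul_single, eq_mul_inv_iff_mul_eq]
  split_ifs with e
  · subst e
    have e₁ : x * h * h' * (h * h')⁻¹ = x := by group
    simp only [e₁, mul_inv_cancel_right, map_mul, α.φ_φ, α.φ_c]
    simp [mul_assoc]
  · rfl

theorem one_eq_sum_stdGen : (1 : Matrix G G A) = ∑ g, α.stdGen g 1 1 := by
  simp [one_eq_sum_single, stdGen_apply, WeakAction.c_one_right]

theorem comul_stdGen (g h : G) (a : A) : comul (R := k) (α.stdGen g h a) =
    TensorProduct.map (α.stdGen g h) (α.stdGen g h) (comul (R := k) a) := by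
  rw [stdGen_apply, comul_single, Bialgebra.comul_mul, α.comul_c_hopf, α.comul_φ]
  generalize comul (R := k) a = X
  induction X with
  | zero => simp
  | add u v hu hv => simp only [map_add, add_mul, hu, hv]
  | tmul u v => simp [stdGen_apply]

theorem counit_stdGen (g h : G) (a : A) :
    counit (R := k) (α.stdGen g h a) = counit (R := k) a := by
  rw [stdGen_apply, counit_single, Bialgebra.counit_mul, (α.isGroupLikeElem_c _ _).counit_eq_one,
    α.counit_φ, mul_one]

theorem antipode_stdGen (g h : G) (a : A) : matrixAntipode (k := k) (α.stdGen g h a) =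
    α.stdGen (g * h⁻¹) h⁻¹
      (((α.c h⁻¹ h)⁻¹ : Aˣ) * α.φ h⁻¹ (WeakHopfAlgebra.antipode (k := k) a)) := by
  have e : HopfAlgebra.antipode k (α.φ (g * h⁻¹) a) = α.φ (g * h⁻¹) (HopfAlgebra.antipode k a) :=
    α.antipode_φ _ a
  rw [stdGen_apply, stdGen_apply, matrixAntipode_single, HopfAlgebra.antipode_mul_antidistrib,
    antipode_c, e, map_mul, α.φ_c_inv, α.φ_φ]
  change _ = Matrix.single _ _ (_ * (_ * α.φ _ (HopfAlgebra.antipode k a) * _) * _)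
  simp [WeakAction.c_one_right, mul_assoc]

variable (k G A) in
/-- The diagonal scalar matrices. -/
noncomputable def diagonalScalars : Submodule k (Matrix G G A) :=
  Submodule.span k (Set.range fun i : G => Matrix.single i i (1 : A))

theorem single_mem_diagonalScalars (i : G) : Matrix.single i i (1 : A) ∈ diagonalScalars k G A :=
  Submodule.subset_span ⟨i, rfl⟩

/-- The diagonal scalar matrices are `K(G) ⊗ 1 ⊗ 1`. -/
theorem range_stdEquiv_one : LinearMap.range (α.stdEquiv.toLinearMap ∘ₗ
    (TensorProduct.mk k (G → k) (A ⊗[k] MonoidAlgebra k G)).flip (1 ⊗ₜ[k] 1)) =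
    diagonalScalars k G A := by
  have e : ∀ i, α.stdEquiv (Pi.single i 1 ⊗ₜ[k] (1 ⊗ₜ[k] 1)) = Matrix.single i i 1 := fun i => by
    rw [MonoidAlgebra.one_def, ← stdGen_eq, stdGen_apply]
    simp [WeakAction.c_one_right]
  apply le_antisymm
  · rintro _ ⟨f, rfl⟩
    rw [LinearMap.comp_apply, ← LinearMap.sum_single_apply (φ := fun _ : G => k) f]
    simp only [map_sum]
    refine sum_mem fun i _ => ?_
    rw [show Pi.single i (f i) = f i • Pi.single i (1 : k) by simp [← Pi.single_smul]]
    rw [map_smul, map_smul]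
    refine Submodule.smul_mem _ _ ?_
    have := e i
    rw [LinearMap.flip_apply, TensorProduct.mk_apply, LinearEquiv.coe_coe, this]
    exact single_mem_diagonalScalars i
  · rw [diagonalScalars, Submodule.span_le]
    rintro _ ⟨i, rfl⟩
    exact ⟨Pi.single i 1, e i⟩

theorem range_counitT_matrix :
    LinearMap.range (counitT k (Matrix G G A)) = diagonalScalars k G A := by
  apply le_antisymm
  · rintro _ ⟨X, rfl⟩
    induction X using Matrix.induction_on' with
    | h_zero => simp
    | h_add p q hp hq => rw [map_add]; exact add_mem hp hq
    | h_std_basis i j a =>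
      rw [counitT_single]
      exact Submodule.smul_mem _ _ (single_mem_diagonalScalars i)
  · rw [diagonalScalars, Submodule.span_le]
    rintro _ ⟨i, rfl⟩
    exact ⟨Matrix.single i i 1, by simp [counitT_single]⟩

theorem range_counitS_matrix :
    LinearMap.range (counitS k (Matrix G G A)) = diagonalScalars k G A := by
  apply le_antisymm
  · rintro _ ⟨X, rfl⟩
    induction X using Matrix.induction_on' with
    | h_zero => simp
    | h_add p q hp hq => rw [map_add]; exact add_mem hp hq
    | h_std_basis i j a =>
      rw [counitS_single]
      exact Submodule.smul_mem _ _ (single_mem_diagonalScalars j)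
  · rw [diagonalScalars, Submodule.span_le]
    rintro _ ⟨i, rfl⟩
    exact ⟨Matrix.single i i 1, by simp [counitS_single]⟩

theorem matrixAction_stdGen (x g h : G) (a : A) :
    α.matrixAction.φ x (α.stdGen g h a) = α.stdGen (x * g) h a := by
  rw [stdGen_apply, matrixAction_φ_single, stdGen_apply, map_mul, α.φ_c, α.φ_φ]
  simp [mul_assoc]

variable (k G) in
/-- The identification of `M ⊗ K[G]` with row vectors. -/
noncomputable def stdRow (M : RMod k A) : M ⊗[k] MonoidAlgebra k G ≃ₗ[k] RMod.rowObj G M :=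
  tensorGroupAlgebra k G M

theorem rowEval_stdRow (M : RMod k A) (m : M) (y : MonoidAlgebra k G) (x : G) :
    RMod.rowEval M x (stdRow k G M (m ⊗ₜ y)) = y.coeff x • m :=
  tensorGroupAlgebra_tmul m y x

theorem stdRow_single (M : RMod k A) (m : M) (x : G) :
    stdRow k G M (m ⊗ₜ MonoidAlgebra.single x 1) = RMod.rowSingle M x m :=
  RMod.row_eval_ext fun y => by
    rw [rowEval_stdRow, RMod.rowEval_rowSingle]
    by_cases h : x = y <;> simp [h]

theorem act_stdRow (M : RMod k A) (m : M) (x g h : G) (a : A) :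
    (RMod.rowObj G M).act (α.stdGen g h a) (stdRow k G M (m ⊗ₜ[k] MonoidAlgebra.single x (1 : k))) =
      if x * h = g then
        stdRow k G M (M.act (α.φ x a * (α.c x h : A)) m ⊗ₜ[k] MonoidAlgebra.single g (1 : k))
      else 0 := by
  rw [stdRow_single, stdRow_single, stdGen_apply, RMod.act_rowSingle]
  simp only [eq_mul_inv_iff_mul_eq]
  split_ifs with e
  · subst e; simp
  · rfl

/-- The strictification by matrices is `K(G) ⊗ A ⊗ K[G]`. -/
noncomputable def standardForm : StandardForm α.matrixStrictification where
  e := α.stdEquiv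
  gen := α.stdGen
  gen_def := α.stdGen_eq
  mul_gen g a h g' a' h' := α.stdGen_mul_stdGen g h g' h' a a'
  one_eq := α.one_eq_sum_stdGen
  comul_gen g a h := α.comul_stdGen g h a
  counit_gen g a h := α.counit_stdGen g h a
  antipode_gen g a h := α.antipode_stdGen g h a
  range_counitT := range_counitT_matrix.trans α.range_stdEquiv_one.symm
  range_counitS := range_counitS_matrix.trans α.range_stdEquiv_one.symm
  φ_gen x g a h := α.matrixAction_stdGen x g h a
  θ := stdRow k G
  act_θ := α.act_stdRow
  map_θ M N f m y := by
    change (RMod.rowMap G f).lin (stdRow k G M (m ⊗ₜ y)) = stdRow k G N (f.lin m ⊗ₜ y)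
    refine RMod.row_eval_ext fun x => ?_
    rw [rowEval_stdRow, ← map_smul, ← rowEval_stdRow]
    rfl

end HopfAction

end GHopf

theorem theorem4p2 {k G A : Type u} [Field k] [Group G] [Fintype G] [DecidableEq G]
    [Ring A] [HopfAlgebra k A] (α : GHopf.HopfAction k G A) :
    (∃ S : GHopf.Strictification α, Nonempty (GHopf.StandardForm S)) ∧
    (∀ 𝒜 : GHopf.Grading α, ∃ S : GHopf.GradedStrictification α 𝒜,
      Nonempty (GHopf.StandardForm S.toStrictification)) :=
  ⟨⟨α.matrixStrictification, ⟨α.standardForm⟩⟩,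
    fun 𝒜 => ⟨𝒜.matrixStrictification, ⟨α.standardForm⟩⟩⟩
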